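/- Let $(\mathcal M,g)$ be a smooth Riemannian manifold without boundary (Hausdorff, second countable, possibly incomplete as a metric space), with Riemannian distance $d$ and Riemannian volume measure $\mu_g$. Let $\mathcal V\to\mathcal M$ be a smooth real vector bundle of finite rank with a smooth metric $h$ and a smooth connection $\nabla$ that is compatible with $h$, i.e. $X\,h(u,v)=h(\nabla_Xu,v)+h(u,\nabla_Xv)$. Let $\|\cdot\|$ denote the $L^2$ norms of (measurable) sections of $\mathcal V$ and of $T^*\mathcal M\otimes\mathcal V$ with respect to $\mu_g$, $h$ and $g$. Let $S_1(\mathcal V)$ be the set of $u\in C^\infty\cap L^2(\mathcal V)$ with $\nabla u\in C^\infty\cap L^2(T^*\mathcal M\otimes\mathcal V)$. Let $W^{1,2}(\mathcal V)$ and $W^{1,2}_0(\mathcal V)$ be the closures of $S_1(\mathcal V)$ and of $C_c^\infty(\mathcal V)$, respectively, under the norm $\|u\|+\|\nabla u\|$; that is, the sets of those $u\in L^2(\mathcal V)$ for which there are $\eta\in L^2(T^*\mathcal M\otimes\mathcal V)$ and a sequence $s_k$ in $S_1(\mathcal V)$, respectively in $C_c^\infty(\mathcal V)$, with $\|s_k-u\|\to0$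 and $\|\nabla s_k-\eta\|\to0$. One writes $\nabla u:=\eta$. For the trivial real line bundle with $\nabla=\mathrm d$ this gives the space $W^{1,2}(\mathcal M)$ of real functions $u$ and their differentials $\mathrm du$. Let $\overline{\mathcal M}$ be the metric completion of $(\mathcal M,d)$ and $\partial_C\mathcal M:=\overline{\mathcal M}\setminus\mathcal M$ the Cauchy boundary. For an open set $\Omega\subset\overline{\mathcal M}$, let $$\mathcal L(\Omega)=\{u\in W^{1,2}(\mathcal M):\ 0\le u\le1\ \text{a.e. and } u=1 \text{ a.e. on } \Omega\cap\mathcal M\},\qquad \mathrm{Cap}(\Omega)=\inf_{u\in\mathcal L(\Omega)}\int_{\mathcal M}\bigl(|u|^2+|\mathrm du|^2\bigr)\,d\mu_g,$$ with $\mathrm{Cap}(\Omega)=\infty$ if $\mathcal L(\Omega)=\emptyset$. For an arbitrary $\Sigma\subset\overline{\mathcal M}$, let $\mathrm{Cap}(\Sigma)$ be the infimum of $\mathrm{Cap}(\Omega)$ over the open sets $\Omega\subset\overline{\mathcal M}$ with $\Sigma\subset\Omega$. The set $\Sigma$ is called polar if $\mathrm{Cap}(\Sigma)=0$. **Theorem.**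 If $\partial_C\mathcal M$ is polar, then $W^{1,2}_0(\mathcal V)=W^{1,2}(\mathcal V)$. -/

import Mathlib

open MeasureTheory Filter Set Bundle
open scoped Manifold ContDiff Topology ENNReal

noncomputable section

namespace RiemannianSobolev

/-! ### The Riemannian volume measure -/

section Volume

variable {n : ℕ} {M : Type*} [EMetricSpace M] [ChartedSpace (EuclideanSpace ℝ (Fin n)) M]
  [RiemannianBundle (fun x : M => TangentSpace (𝓡 n) x)]

/-- The coordinate vector field `∂_i` of the chart at `c`, at the point with coordinates `y`. -/
def coordVector (c : M) (y : EuclideanSpace ℝ (Fin n)) (i : Fin n) :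
    TangentSpace (𝓡 n) ((chartAt (EuclideanSpace ℝ (Fin n)) c).symm y) :=
  mfderiv (𝓡 n) (𝓡 n) (chartAt (EuclideanSpace ℝ (Fin n)) c).symm y
    (EuclideanSpace.single i (1 : ℝ) : EuclideanSpace ℝ (Fin n))

/-- The Gram matrix `g_ij = g(∂_i, ∂_j)` in the chart at `c`. -/
def gramMatrix (c : M) (y : EuclideanSpace ℝ (Fin n)) : Matrix (Fin n) (Fin n) ℝ :=
  Matrix.of fun i j => inner ℝ (coordVector c y i) (coordVector c y j)

variable [MeasurableSpace M]

/-- The measure `√(det g_ij) dy` of the chart at `c`, transported to `M` (it is carried by the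
domain of the chart). -/
def chartVolume (c : M) : Measure M :=
  Measure.map (chartAt (EuclideanSpace ℝ (Fin n)) c).symm
    (((volume : Measure (EuclideanSpace ℝ (Fin n))).restrict
      (chartAt (EuclideanSpace ℝ (Fin n)) c).target).withDensity
        fun y => ENNReal.ofReal (Real.sqrt (gramMatrix c y).det))

variable (n M) in
/-- The Riemannian volume measure `μ_g`: the measures `chartVolume c` agree on the overlaps of the
charts, and `μ_g` is obtained by gluing them, i.e. it is the least measure on `M` which dominates
all of them. -/
def riemannianVolume : Measure M := ⨆ c : M, chartVolume (n := n) c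

end Volume

/-! ### Square integrable sections, and the Sobolev spaces -/

section Sobolev

variable {n : ℕ} {M : Type*} [EMetricSpace M] [ChartedSpace (EuclideanSpace ℝ (Fin n)) M]
  [IsManifold (𝓡 n) ∞ M]
  [RiemannianBundle (fun x : M => TangentSpace (𝓡 n) x)] [MeasurableSpace M]

/-- A section is measurable if its coefficients in the local trivialisations are (Lebesgue)
measurable. -/
def MeasurableSection (n : ℕ) {M : Type*} [EMetricSpace M]
    [ChartedSpace (EuclideanSpace ℝ (Fin n)) M]
    [RiemannianBundle (fun x : M => TangentSpace (𝓡 n) x)] [MeasurableSpace M]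
    (F : Type*) [TopologicalSpace F] {V : M → Type*} [TopologicalSpace (TotalSpace F V)]
    [∀ x, TopologicalSpace (V x)] [FiberBundle F V] (u : ∀ x, V x) : Prop :=
  ∀ c : M, AEStronglyMeasurable (fun x => (trivializationAt F V c ⟨x, u x⟩).2)
    ((riemannianVolume n M).restrict (trivializationAt F V c).baseSet)

variable (n) in
/-- The square `∫ |u|² dμ_g` of the `L²` norm of a section of `V`. -/
def normSq {V : M → Type*} [∀ x, NormedAddCommGroup (V x)] (u : ∀ x, V x) : ℝ≥0∞ :=
  ∫⁻ x, ‖u x‖ₑ ^ 2 ∂(riemannianVolume n M)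

/-- The square of the norm of an element of `T*_xM ⊗ V_x = Hom(T_xM, V_x)` for the tensor product
metric: `|η|² = ∑ |η(e_i)|²` for an orthonormal basis `e_i` of `T_xM`. -/
def tensorNormSq {x : M} {W : Type*} [NormedAddCommGroup W] [NormedSpace ℝ W]
    (η : TangentSpace (𝓡 n) x →L[ℝ] W) : ℝ≥0∞ :=
  haveI : FiniteDimensional ℝ (TangentSpace (𝓡 n) x) :=
    inferInstanceAs (FiniteDimensional ℝ (EuclideanSpace ℝ (Fin n)))
  ∑ i, ‖η (stdOrthonormalBasis ℝ (TangentSpace (𝓡 n) x) i)‖ₑ ^ 2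

/-- The square `∫ |η|² dμ_g` of the `L²` norm of a section of `T*M ⊗ V`. -/
def formNormSq {V : M → Type*} [∀ x, NormedAddCommGroup (V x)] [∀ x, InnerProductSpace ℝ (V x)]
    (η : ∀ x, TangentSpace (𝓡 n) x →L[ℝ] V x) : ℝ≥0∞ :=
  ∫⁻ x, tensorNormSq (η x) ∂(riemannianVolume n M)

variable (F : Type*) [NormedAddCommGroup F] [NormedSpace ℝ F]
  {V : M → Type*} [TopologicalSpace (TotalSpace F V)]
  [∀ x, NormedAddCommGroup (V x)] [∀ x, InnerProductSpace ℝ (V x)]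
  [FiberBundle F V] [VectorBundle ℝ F V]
  (D : (∀ x, V x) → ∀ x, TangentSpace (𝓡 n) x →L[ℝ] V x)

/-- `S_1(V)`: the smooth square integrable sections `u` for which `Du` is smooth and square
integrable. -/
def smoothSobolev : Set (∀ x, V x) :=
  {u | ContMDiff (𝓡 n) ((𝓡 n).prod 𝓘(ℝ, F)) ∞ (fun x => TotalSpace.mk' F x (u x)) ∧
    normSq n u < ⊤ ∧
    ContMDiff (𝓡 n) ((𝓡 n).prod 𝓘(ℝ, EuclideanSpace ℝ (Fin n) →L[ℝ] F)) ∞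
      (fun x => TotalSpace.mk' (EuclideanSpace ℝ (Fin n) →L[ℝ] F)
        (E := fun x : M => TangentSpace (𝓡 n) x →L[ℝ] V x) x (D u x)) ∧
    formNormSq (D u) < ⊤}

variable (n) in
/-- `C_c^∞(V)`: the smooth sections with compact support. -/
def smoothCompact (V : M → Type*) [TopologicalSpace (TotalSpace F V)]
    [∀ x, NormedAddCommGroup (V x)] [∀ x, InnerProductSpace ℝ (V x)] [FiberBundle F V] :
    Set (∀ x, V x) :=
  {u | ContMDiff (𝓡 n) ((𝓡 n).prod 𝓘(ℝ, F)) ∞ (fun x => TotalSpace.mk' F x (u x)) ∧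
    ∃ K : Set M, IsCompact K ∧ ∀ x, x ∉ K → u x = 0}

/-- The pair `(u, η)` of square integrable sections of `V` and of `T*M ⊗ V` is the limit in `L²` of
pairs `(s_k, D s_k)` with `s_k ∈ S`. In other words, `u` is in the closure of `S` for the norm
`‖u‖ + ‖Du‖`, and `η` is `Du`. -/
def InGraphClosure (S : Set (∀ x, V x)) (u : ∀ x, V x)
    (η : ∀ x, TangentSpace (𝓡 n) x →L[ℝ] V x) : Prop :=
  MeasurableSection n F u ∧ normSq n u < ⊤ ∧
  MeasurableSection n (V := fun x : M => TangentSpace (𝓡 n) x →L[ℝ] V x)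
    (EuclideanSpace ℝ (Fin n) →L[ℝ] F) η ∧ formNormSq η < ⊤ ∧
  ∃ s : ℕ → ∀ x, V x, (∀ k, s k ∈ S) ∧
    Tendsto (fun k => normSq n fun x => s k x - u x) atTop (𝓝 0) ∧
    Tendsto (fun k => formNormSq fun x => D (s k) x - η x) atTop (𝓝 0)

/-- `W^{1,2}(V)`: the closure of `S_1(V)` for the norm `‖u‖ + ‖Du‖`. -/
def sobolevW : Set (∀ x, V x) :=
  {u | ∃ η, InGraphClosure F D (smoothSobolev F D) u η}

/-- `W_0^{1,2}(V)`: the closure of `C_c^∞(V)` for the norm `‖u‖ + ‖Du‖`. -/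
def sobolevW0 : Set (∀ x, V x) :=
  {u | ∃ η, InGraphClosure F D (smoothCompact n F V) u η}

end Sobolev

/-! ### The Cauchy boundary, and the capacity -/

section Capacity

variable (n : ℕ) (M : Type*) [EMetricSpace M] [ChartedSpace (EuclideanSpace ℝ (Fin n)) M]

/-- The exterior derivative of functions, as a connection on the trivial line bundle. -/
def scalarDifferential (f : ∀ x : M, Bundle.Trivial M ℝ x) (x : M) :
    TangentSpace (𝓡 n) x →L[ℝ] Bundle.Trivial M ℝ x :=
  mvfderiv (𝓡 n) (fun z => (f z : ℝ)) x

/-- The Cauchy boundary: the complement of `M` in its metric completion. -/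
def cauchyBoundary (M : Type*) [EMetricSpace M] : Set (UniformSpace.Completion M) :=
  (range ((↑) : M → UniformSpace.Completion M))ᶜ

variable [IsManifold (𝓡 n) ∞ M]
  [RiemannianBundle (fun x : M => TangentSpace (𝓡 n) x)] [MeasurableSpace M]

variable {M}

/-- `(u, η)` consists of a function `u ∈ W^{1,2}(M)` with `0 ≤ u ≤ 1` and `u = 1` on `Ω ∩ M`
(almost everywhere), and of its differential `η = du`. -/
def IsAdmissible (Ω : Set (UniformSpace.Completion M)) (u : ∀ x : M, Bundle.Trivial M ℝ x)
    (η : ∀ x : M, TangentSpace (𝓡 n) x →L[ℝ] Bundle.Trivial M ℝ x) : Prop :=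
  InGraphClosure ℝ (scalarDifferential n M) (smoothSobolev ℝ (scalarDifferential n M)) u η ∧
  (∀ᵐ x : M ∂(riemannianVolume n M), (0 : ℝ) ≤ u x ∧ u x ≤ (1 : ℝ)) ∧
  ∀ᵐ x : M ∂(riemannianVolume n M), (x : UniformSpace.Completion M) ∈ Ω → u x = (1 : ℝ)

/-- The 1-capacity of an open subset of the completion: the infimum of `∫ |u|² + |du|²` over the
admissible functions `u` (it is `∞` if there is none). -/
def capOpen (Ω : Set (UniformSpace.Completion M)) : ℝ≥0∞ :=
  ⨅ (u : ∀ x : M, Bundle.Trivial M ℝ x)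
    (η : ∀ x : M, TangentSpace (𝓡 n) x →L[ℝ] Bundle.Trivial M ℝ x)
    (_ : IsAdmissible n Ω u η), normSq n u + formNormSq η

/-- The 1-capacity of an arbitrary subset of the completion. -/
def capacity (A : Set (UniformSpace.Completion M)) : ℝ≥0∞ :=
  ⨅ (Ω : Set (UniformSpace.Completion M)) (_ : IsOpen Ω) (_ : A ⊆ Ω), capOpen n Ω

/-- A subset of the completion is polar if it has zero 1-capacity. -/
def IsPolar (A : Set (UniformSpace.Completion M)) : Prop := capacity n A = 0

end Capacity

end RiemannianSobolev

end

/-! Both spaces are closures, so the point is to approximate a smooth `u` of finite energy, up to a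
small error in `‖u‖² + ‖∇u‖²`, by compactly supported smooth sections; the inclusion of `W^{1,2}` in
`W_0^{1,2}` then follows by choosing an approximation of each term of an approximating sequence.

First, `u` may be assumed bounded: `u / (1 + δ|u|²)` is bounded and converges to `u` in energy as `δ
→ 0`. Metric compatibility enters here, through `d|u|² = 2⟨u, ∇u⟩` (`exists_truncation_energy_le`,
`exists_bounded_approx`).

A bounded `u` is multiplied by `χ (1 - τ(s))`, where `τ` is `ratTrunc` and the two factors deal with
the Cauchy boundary and with infinity. Polarity gives an open neighbourhood `Ω` of the boundary in
the completion and a potential `φ` of small energy equal to `1` on `Ω`; `s` is a smooth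
approximation of `φ`. Since `|u|` is bounded, the term `|u|²|ds|²` has small integral. The set `A =
M \ Ω` is closed in the completion, hence complete, and on `A` there is a smooth cutoff `χ` with
compact support and arbitrarily small gradient (`exists_cutoff`). Off `A` the gradient of `χ` is
merely bounded on its support, but there `φ = 1`, so `1 - τ(s)` is small in `L²`, as small as
desired, because `s` is chosen after `χ`. This order of choices is the heart of
`exists_smoothCompact_approx_of_bounded`.

The cutoff `χ` would be a function of the distance if `M` were complete. Here the distance is
replaced by `testSup`, the supremum of the smooth functions that are nonpositive on `K` and have
gradient at most `Λ` on `A` only. It may be infinite and is only lower semicontinuous, but it has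
slope at least one on `A` (`testSup_slope`): otherwise a small bump could be added to a truncated
test function to exceed the supremum. Ekeland's principle turns the slope into a distance estimate
between sublevel sets, and the Hopf-Rinow continuity argument makes the sublevel sets in `A` compact
(`isCompact_sublevel_of_slope`). Being a supremum of smooth functions, `testSup` needs no
regularisation: on a compact set, finitely many test functions joined by smooth maxima suffice.

The volume is used only as a Borel measure on `M`. -/

noncomputable section

namespace RiemannianSobolev

/-! ### Ekeland's principle, and compactness of sublevel sets -/

section Metric

open scoped NNReal

variable {X : Type*} [EMetricSpace X] {A : Set X} {f : X → ℝ≥0∞}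

/-- **Ekeland's variational principle** on a complete set. -/
theorem exists_ekeland_minimal (hA : IsComplete A) (hf : LowerSemicontinuous f) {x₀ : X}
    (hx₀ : x₀ ∈ A) (hfin : f x₀ ≠ ⊤) :
    ∃ y ∈ A, f y + edist x₀ y ≤ f x₀ ∧ ∀ z ∈ A, f z + edist y z ≤ f y → z = y := by
  set F : X → Set X := fun x => {z | z ∈ A ∧ f z + edist x z ≤ f x} with hF
  have hself : ∀ x ∈ A, x ∈ F x := fun x hx => ⟨hx, by simp⟩
  have htrans : ∀ {x y z}, y ∈ F x → z ∈ F y → z ∈ F x := by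
    rintro x y z ⟨-, hy⟩ ⟨hzA, hz⟩
    refine ⟨hzA, ?_⟩
    calc f z + edist x z ≤ f z + (edist x y + edist y z) := by gcongr; exact edist_triangle _ _ _
      _ = (f z + edist y z) + edist x y := by ring
      _ ≤ f y + edist x y := by gcongr
      _ ≤ f x := hy
  have hstep : ∀ (ε : ℝ≥0∞), 0 < ε → ∀ x, x ∈ A → f x ≠ ⊤ →
      ∃ y ∈ F x, f y < (⨅ z ∈ F x, f z) + ε := by
    intro ε hε x hx hfx
    have hm : (⨅ z ∈ F x, f z) ≠ ⊤ :=
      ne_top_of_le_ne_top hfx (iInf₂_le x (hself x hx))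
    have := ENNReal.lt_add_right hm hε.ne'
    obtain ⟨y, hy⟩ := iInf_lt_iff.1 this
    obtain ⟨hyF, hy⟩ := iInf_lt_iff.1 hy
    exact ⟨y, hyF, hy⟩
  have hfinF : ∀ {x y}, y ∈ F x → f x ≠ ⊤ → f y ≠ ⊤ := by
    rintro x y ⟨-, hy⟩ hfx
    exact ne_top_of_le_ne_top hfx (le_self_add.trans hy)
  -- This is `2⁻ᵏ`, in the shape `C / 2 ^ k` of the geometric Cauchy criterion. Choosing the next
  -- point almost minimal for `f` on `F (u k)` forces `F (u (k + 1))` into a ball of radius `ε k`.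
  let ε : ℕ → ℝ≥0∞ := fun k => 2 / 2 / 2 ^ k
  have hε : ∀ k, 0 < ε k := fun k => by
    simp only [ε]
    exact ENNReal.div_pos (by simp) (by simp)
  have hε0 : Tendsto ε atTop (𝓝 0) := by
    have : ε = fun k => (2⁻¹ : ℝ≥0∞) ^ k := by
      ext k
      simp only [ε]
      rw [ENNReal.div_self (by simp) (by simp), one_div, ENNReal.inv_pow]
    rw [this]
    exact ENNReal.tendsto_pow_atTop_nhds_zero_of_lt_one (by simp)
  let Y := {x : X // x ∈ A ∧ f x ≠ ⊤}
  choose g hgF hg using fun (k : ℕ) (x : Y) => hstep (ε k) (hε k) x.1 x.2.1 x.2.2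
  let u : ℕ → Y := fun k => Nat.rec ⟨x₀, hx₀, hfin⟩
    (fun k x => ⟨g k x, (hgF k x).1, hfinF (hgF k x) x.2.2⟩) k
  have huF : ∀ k, (u (k + 1)).1 ∈ F (u k).1 := fun k => hgF k (u k)
  have hu : ∀ k, f (u (k + 1)).1 < (⨅ z ∈ F (u k).1, f z) + ε k := fun k => hg k (u k)
  have hsmall : ∀ k z, z ∈ F (u (k + 1)).1 → edist (u (k + 1)).1 z ≤ ε k := by
    intro k z hz
    have h1 : (⨅ w ∈ F (u k).1, f w) ≤ f z := iInf₂_le z (htrans (huF k) hz)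
    have h2 : f z + edist (u (k + 1)).1 z ≤ f z + ε k :=
      hz.2.trans ((hu k).le.trans (by gcongr))
    exact (ENNReal.add_le_add_iff_left (hfinF hz (u (k + 1)).2.2)).1 h2
  have hmono : ∀ k l, (u (k + l)).1 ∈ F (u k).1 := by
    intro k l
    induction l with
    | zero => exact hself _ (u k).2.1
    | succ l ih => exact htrans ih (huF (k + l))
  obtain ⟨y, hyA, hy⟩ := cauchySeq_tendsto_of_isComplete hA (u := fun k => (u (k + 1)).1)
    (fun k => (u (k + 1)).2.1)
    (cauchySeq_of_edist_le_geometric_two (2 / 2) (by simp [ENNReal.div_self]) fun k => hsmall k _ (huF (k + 1)))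
  have hclosed : ∀ x, IsClosed {z | f z + edist x z ≤ f x} := fun x =>
    (hf.add (continuous_const.edist continuous_id).lowerSemicontinuous).isClosed_preimage (f x)
  have hyF : ∀ k, y ∈ F (u k).1 := by
    intro k
    refine ⟨hyA, (hclosed (u k).1).mem_of_tendsto hy ?_⟩
    filter_upwards [eventually_ge_atTop k] with l hl
    obtain ⟨m, rfl⟩ := Nat.exists_eq_add_of_le hl
    exact (hmono k (m + 1)).2
  refine ⟨y, hyA, (hyF 0).2, fun z hzA hz => ?_⟩
  have h1 : Tendsto (fun k => edist (u (k + 1)).1 z) atTop (𝓝 0) :=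
    tendsto_of_tendsto_of_tendsto_of_le_of_le tendsto_const_nhds hε0 (fun _ => zero_le)
      fun k => hsmall k z (htrans (hyF (k + 1)) ⟨hzA, hz⟩)
  exact (tendsto_nhds_unique hy (tendsto_iff_edist_tendsto_0.2 h1)).symm

/-- If `f` has slope at least one above the level `R`, then the distance to the sublevel set
`{f ≤ R}` is controlled by `f - R`. -/
theorem exists_edist_le_of_slope (hA : IsComplete A) (hf : LowerSemicontinuous f) {R R' : ℝ≥0}
    (hslope : ∀ x ∈ A, R < f x → f x ≠ ⊤ → ∃ y ∈ A, y ≠ x ∧ max (f y) R + edist x y ≤ f x)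
    (hR : R ≤ R') {x : X} (hx : x ∈ A) (hfx : f x ≤ R') :
    ∃ y ∈ A, f y ≤ R ∧ edist x y ≤ (R' - R : ℝ≥0) := by
  -- Ekeland is applied to `max f R`: by the slope condition, a minimal point cannot lie above the
  -- level `R`.
  have hlsc : LowerSemicontinuous fun z => max (f z) R := hf.sup lowerSemicontinuous_const
  obtain ⟨y, hyA, hxy, hmin⟩ := exists_ekeland_minimal hA hlsc hx
    (ne_top_of_le_ne_top ENNReal.coe_ne_top (max_le hfx (ENNReal.coe_le_coe.2 hR)))
  have hxy' : max (f y) R + edist x y ≤ R' := hxy.trans (max_le hfx (ENNReal.coe_le_coe.2 hR))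
  have hyR : f y ≤ R := by
    by_contra! h
    obtain ⟨z, hzA, hzy, hz⟩ := hslope y hyA h
      (ne_top_of_le_ne_top ENNReal.coe_ne_top ((le_max_left _ _).trans (le_self_add.trans hxy')))
    exact hzy (hmin z hzA (hz.trans (le_max_left _ _)))
  refine ⟨y, hyA, hyR, ?_⟩
  rw [max_eq_right hyR] at hxy'
  rw [ENNReal.coe_sub]
  exact ENNReal.le_sub_of_add_le_left ENNReal.coe_ne_top hxy'

/-- The **Hopf-Rinow** argument for the sublevel sets of a function with slope at least one. -/
theorem isCompact_sublevel_of_slope [LocallyCompactSpace X] (hA : IsComplete A)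
    (hf : LowerSemicontinuous f)
    (hslope : ∀ R : ℝ≥0, ∀ x ∈ A, R < f x → f x ≠ ⊤ →
      ∃ y ∈ A, y ≠ x ∧ max (f y) R + edist x y ≤ f x)
    (h0 : IsCompact {x | x ∈ A ∧ f x ≤ 0}) (R : ℝ≥0) : IsCompact {x | x ∈ A ∧ f x ≤ R} := by
  set S : ℝ≥0 → Set X := fun R => {x | x ∈ A ∧ f x ≤ R} with hS
  have hclosed : ∀ R, IsClosed (S R) := fun R => hA.isClosed.inter (hf.isClosed_preimage _)
  have hnear : ∀ {R R' : ℝ≥0}, R ≤ R' → ∀ x ∈ S R', ∃ y ∈ S R, edist x y ≤ (R' - R : ℝ≥0) := by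
    intro R R' h x hx
    obtain ⟨y, hy, h1, h2⟩ := exists_edist_le_of_slope hA hf (hslope R) h hx.1 hx.2
    exact ⟨y, ⟨hy, h1⟩, h2⟩
  by_contra hR
  set s : Set ℝ≥0 := {R | IsCompact (S R)} with hs
  have hdown : ∀ {R R'}, R ≤ R' → R' ∈ s → R ∈ s := fun {R R'} h h' =>
    IsCompact.of_isClosed_subset h' (hclosed R)
      fun x hx => ⟨hx.1, hx.2.trans (ENNReal.coe_le_coe.2 h)⟩
  have h0s : (0 : ℝ≥0) ∈ s := by simpa [hs, hS] using h0
  have hbdd : BddAbove s := ⟨R, fun r hr => by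
    by_contra! h
    exact hR (hdown h.le hr)⟩
  set T := sSup s with hT
  -- The supremum is attained: `S T` lies within `δ` of a compact `S r` with `T ≤ r + δ`, so it is
  -- totally bounded, and it is closed in the complete set `A`.
  have hTs : T ∈ s := by
    refine isCompact_iff_totallyBounded_isComplete.2 ⟨?_, ?_⟩
    · refine EMetric.totallyBounded_iff.2 fun ε hε => ?_
      obtain ⟨δ, hδ0, hδ⟩ := ENNReal.lt_iff_exists_nnreal_btwn.1 (ENNReal.half_pos hε.ne')
      have hδ0' : 0 < δ := by exact_mod_cast hδ0
      obtain ⟨r, hr, hrT⟩ : ∃ r ∈ s, T ≤ r + δ := by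
        rcases le_or_gt T δ with h | h
        · exact ⟨0, h0s, by simpa using h⟩
        · obtain ⟨r, hr, hr'⟩ := exists_lt_of_lt_csSup ⟨0, h0s⟩
            (tsub_lt_self (hδ0'.trans h) hδ0' : T - δ < T)
          exact ⟨r, hr, tsub_le_iff_right.1 hr'.le⟩
      obtain ⟨t, ht, hcov⟩ := EMetric.totallyBounded_iff.1 hr.totallyBounded (ε / 2)
        (ENNReal.half_pos hε.ne')
      refine ⟨t, ht, fun x hx => ?_⟩
      obtain ⟨y, hy, hxy⟩ := hnear (le_csSup hbdd hr) x hx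
      obtain ⟨z, hz, hyz⟩ := mem_iUnion₂.1 (hcov hy)
      refine mem_iUnion₂.2 ⟨z, hz, ?_⟩
      calc edist x z ≤ edist x y + edist y z := edist_triangle _ _ _
        _ < ε / 2 + ε / 2 := by
          refine ENNReal.add_lt_add (hxy.trans_lt (lt_of_le_of_lt ?_ hδ)) hyz
          exact ENNReal.coe_le_coe.2 (tsub_le_iff_left.2 hrT)
        _ = ε := ENNReal.add_halves ε
    · intro l hl hlT
      obtain ⟨x, -, hx⟩ := hA l hl (hlT.trans (principal_mono.2 fun x hx => hx.1))
      have := hl.1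
      exact ⟨x, (hclosed T).closure_subset
        (mem_closure_iff_clusterPt.2 (this.mono (le_inf hx hlT))), hx⟩
  -- Local compactness pushes past `T`: `S (T + δ)` lies in a compact closed thickening of `S T`,
  -- which contradicts maximality.
  obtain ⟨δ, hδ, hcomp⟩ := IsCompact.exists_isCompact_cthickening (s := S T) hTs
  lift δ to ℝ≥0 using hδ.le
  have hmem : T + δ ∈ s := by
    refine IsCompact.of_isClosed_subset hcomp (hclosed _) fun x hx => ?_
    obtain ⟨y, hy, hxy⟩ := hnear (le_self_add : T ≤ T + δ) x hx
    refine Metric.mem_cthickening_of_edist_le x y _ _ hy ?_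
    simpa using hxy
  have := le_csSup hbdd hmem
  have hδ' : 0 < δ := by exact_mod_cast hδ
  exact absurd this (not_le.2 (lt_add_of_pos_right T hδ'))

end Metric

end RiemannianSobolev

namespace RiemannianSobolev

/-! ### Bump functions with controlled gradient -/

section Bump

/-- A smooth cutoff of the half-line, with bounded derivative. -/
theorem exists_smooth_halfline_cutoff :
    ∃ (θ : ℝ → ℝ) (C : ℝ), 0 ≤ C ∧ ContDiff ℝ ∞ θ ∧ (∀ t, t ≤ 0 → θ t = 1) ∧ (∀ t, 0 ≤ θ t) ∧
      (∀ t, θ t ≤ 1) ∧ (∀ t, 1 ≤ t → θ t = 0) ∧ ∀ t, |deriv θ t| ≤ C := by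
  set θ : ℝ → ℝ := fun t => Real.smoothTransition (1 - t) with hθ
  have hsm : ContDiff ℝ ∞ θ := Real.smoothTransition.contDiff.comp (contDiff_const.sub contDiff_id)
  have hnn : ∀ t, 0 ≤ θ t := fun t => Real.smoothTransition.nonneg _
  have hle : ∀ t, θ t ≤ 1 := fun t => Real.smoothTransition.le_one _
  have h0 : ∀ t, 1 ≤ t → θ t = 0 := fun t ht =>
    Real.smoothTransition.zero_of_nonpos (by linarith)
  have h1 : ∀ t, t ≤ 0 → θ t = 1 := fun t ht =>
    Real.smoothTransition.one_of_one_le (by linarith)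
  obtain ⟨C, hC⟩ := (isCompact_Icc (a := (0 : ℝ)) (b := 1)).exists_bound_of_continuousOn
    (hsm.continuous_deriv (by simp)).continuousOn
  have hC0 : 0 ≤ C := (norm_nonneg _).trans (hC 0 (by simp))
  refine ⟨θ, C, hC0, hsm, h1, hnn, hle, h0, fun t => ?_⟩
  rcases le_or_gt t 1 with h | h
  · rcases le_or_gt 0 t with h' | h'
    · exact hC t ⟨h', h⟩
    · have : IsLocalMax θ t := Filter.Eventually.of_forall fun y => by
        rw [h1 t h'.le]; exact hle y
      rwa [this.deriv_eq_zero, abs_zero]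
  · have : IsLocalMin θ t := Filter.Eventually.of_forall fun y => by
      rw [h0 t h.le]; exact hnn y
    rwa [this.deriv_eq_zero, abs_zero]

/-- Bump functions on a vector space, adapted to the norm `‖L z‖`, with derivative controlled
independently of their width. -/
theorem exists_bump_of_linear : ∃ Λ : ℝ, 0 ≤ Λ ∧
    ∀ (E W : Type) [NormedAddCommGroup E] [NormedSpace ℝ E] [NormedAddCommGroup W]
      [InnerProductSpace ℝ W] (L : E →L[ℝ] W) (z₀ : E) (ρ : ℝ), 0 < ρ →
      ∃ h : E → ℝ, ContDiff ℝ ∞ h ∧ (∀ z, 0 ≤ h z) ∧ h z₀ = 4 * ρ ∧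
        (∀ z, h z ≠ 0 → ‖L (z - z₀)‖ ≤ ρ) ∧ ∀ z w, |fderiv ℝ h z w| ≤ Λ * ‖L w‖ := by
  obtain ⟨θ, C, hC0, hθ, hθ0, hnn, -, h1, hC⟩ := exists_smooth_halfline_cutoff
  refine ⟨8 * C, by positivity, fun E W _ _ _ _ L z₀ ρ hρ => ?_⟩
  set q : E → ℝ := fun z => ‖L (z - z₀)‖ ^ 2 / ρ ^ 2 with hq
  have hqd : ∀ z, HasFDerivAt q ((2 / ρ ^ 2) • ((innerSL ℝ (L (z - z₀))).comp L)) z := by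
    intro z
    have h2 : HasFDerivAt (fun z => L (z - z₀)) L z :=
      L.hasFDerivAt.comp z ((hasFDerivAt_id z).sub_const z₀)
    have := (h2.norm_sq).const_mul (1 / ρ ^ 2)
    refine (this.congr_of_eventuallyEq (Eventually.of_forall fun y => ?_)).congr_fderiv ?_
    · simp [hq, div_eq_inv_mul]
    · ext w
      simp
      ring
  have hqs : ContDiff ℝ ∞ q :=
    (((L.contDiff.comp (contDiff_id.sub contDiff_const)).norm_sq ℝ).div_const _)
  -- The height is proportional to the width `ρ`, so the derivative is at most `4ρ · C · (2 / ρ²) ·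
  -- ρ = 8C`, whatever `ρ` is.
  refine ⟨fun z => 4 * ρ * θ (q z), contDiff_const.mul (hθ.comp hqs),
    fun z => mul_nonneg (by positivity) (hnn _), by simp [hq, hθ0], fun z hz => ?_, fun z w => ?_⟩
  · by_contra! hlt
    refine hz ?_
    change 4 * ρ * θ (q z) = 0
    rw [h1 _ ?_, mul_zero]
    simp only [hq]
    rw [le_div_iff₀ (by positivity), one_mul]
    gcongr
  · have hd : HasFDerivAt (fun z => 4 * ρ * θ (q z))
        ((4 * ρ) • (deriv θ (q z) • ((2 / ρ ^ 2) • ((innerSL ℝ (L (z - z₀))).comp L)))) z :=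
      (((hθ.differentiable (by simp)).differentiableAt.hasDerivAt.comp_hasFDerivAt z
        (hqd z))).const_mul (4 * ρ)
    rw [hd.fderiv]
    simp only [_root_.smul_apply, ContinuousLinearMap.comp_apply, smul_eq_mul,
      innerSL_apply_apply]
    rcases le_or_gt ‖L (z - z₀)‖ ρ with hle | hlt
    · have hin : |inner ℝ (L (z - z₀)) (L w)| ≤ ρ * ‖L w‖ :=
        (abs_real_inner_le_norm _ _).trans (by gcongr)
      have hCz := hC (q z)
      rw [abs_mul (4 * ρ), abs_mul (deriv θ (q z)), abs_mul (2 / ρ ^ 2),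
        abs_of_pos (show 0 < 4 * ρ by positivity), abs_of_pos (show 0 < 2 / ρ ^ 2 by positivity)]
      calc 4 * ρ * (|deriv θ (q z)| * (2 / ρ ^ 2 * |inner ℝ (L (z - z₀)) (L w)|))
          ≤ 4 * ρ * (C * (2 / ρ ^ 2 * (ρ * ‖L w‖))) := by gcongr
        _ = 8 * C * ‖L w‖ := by field_simp; ring
    · have hmin : IsLocalMin θ (q z) := Filter.Eventually.of_forall fun y => by
        rw [h1 (q z) ?_]
        · exact hnn y
        · simp only [hq]
          rw [le_div_iff₀ (by positivity), one_mul]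
          gcongr
      rw [hmin.deriv_eq_zero]
      simp
      positivity

end Bump

/-! ### Comparison of a chart with the tangent space at its centre -/

section Chart

variable {n : ℕ} {M : Type*} [EMetricSpace M] [ChartedSpace (EuclideanSpace ℝ (Fin n)) M]
  [IsManifold (𝓡 n) ∞ M]
  [RiemannianBundle (fun x : M => TangentSpace (𝓡 n) x)]
  [IsContinuousRiemannianBundle (EuclideanSpace ℝ (Fin n)) (fun x : M => TangentSpace (𝓡 n) x)]

/-- The identification of the model space with the tangent space at `x` given by the chart at `x`. -/
def modelToTangent (x : M) : EuclideanSpace ℝ (Fin n) →L[ℝ] TangentSpace (𝓡 n) x :=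
  (trivializationAt (EuclideanSpace ℝ (Fin n)) (fun x : M => TangentSpace (𝓡 n) x) x).symmL ℝ x

/-- By continuity of the metric, the trivialisation at `x` is almost isometric near `x` once the
model space carries the norm of `T_xM`. The factor `2` does not depend on `x`, which makes the
constant `Λ` of the bump functions uniform; only the size of the neighbourhood varies. -/
theorem eventually_norm_modelToTangent_mfderiv_le (x : M) :
    ∀ᶠ y in 𝓝 x, ∀ v : TangentSpace (𝓡 n) y,
      ‖modelToTangent x (mfderiv (𝓡 n) 𝓘(ℝ, EuclideanSpace ℝ (Fin n)) (extChartAt (𝓡 n) x) y v)‖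
        ≤ 2 * ‖v‖ := by
  have h1 := eventually_norm_symmL_trivializationAt_self_comp_lt (EuclideanSpace ℝ (Fin n))
    (fun x : M => TangentSpace (𝓡 n) x) x one_lt_two
  filter_upwards [h1, chart_source_mem_nhds (EuclideanSpace ℝ (Fin n)) x] with y hy hys v
  rw [TangentBundle.continuousLinearMapAt_trivializationAt hys] at hy
  refine le_trans ?_ (mul_le_mul_of_nonneg_right hy.le (norm_nonneg v))
  exact ContinuousLinearMap.le_opNorm
    ((modelToTangent x) ∘L (mfderiv (𝓡 n) 𝓘(ℝ, EuclideanSpace ℝ (Fin n)) (extChartAt (𝓡 n) x) y)) v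

theorem eventually_norm_mfderiv_symm_le (x : M) :
    ∀ᶠ z in 𝓝 (extChartAt (𝓡 n) x x), ∀ w : EuclideanSpace ℝ (Fin n),
      ‖mfderivWithin 𝓘(ℝ, EuclideanSpace ℝ (Fin n)) (𝓡 n) (extChartAt (𝓡 n) x).symm
        (range (𝓡 n)) z w‖ ≤ 2 * ‖modelToTangent x w‖ := by
  have h1 := eventually_norm_symmL_trivializationAt_comp_self_lt (EuclideanSpace ℝ (Fin n))
    (fun x : M => TangentSpace (𝓡 n) x) x one_lt_two
  have h2 : 𝓝 x = 𝓝 ((extChartAt (𝓡 n) x).symm (extChartAt (𝓡 n) x x)) := by simp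
  have h3 := (continuousAt_extChartAt_symm (I := 𝓡 n) x).eventually
    (h2 ▸ (h1.and (chart_source_mem_nhds (EuclideanSpace ℝ (Fin n)) x)))
  filter_upwards [h3, extChartAt_target_mem_nhds (I := 𝓡 n) x] with z hz hzt w
  obtain ⟨hz, hzs⟩ := hz
  have hx := FiberBundle.mem_baseSet_trivializationAt' (F := EuclideanSpace ℝ (Fin n))
    (E := fun x : M => TangentSpace (𝓡 n) x) x
  have hw : (trivializationAt (EuclideanSpace ℝ (Fin n)) (fun x : M => TangentSpace (𝓡 n) x)
      x).continuousLinearMapAt ℝ x (modelToTangent x w) = w :=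
    Trivialization.continuousLinearMapAt_symmL _ hx w
  have key := (ContinuousLinearMap.le_opNorm _ (modelToTangent x w)).trans
    (mul_le_mul_of_nonneg_right hz.le (norm_nonneg _))
  rw [ContinuousLinearMap.comp_apply, hw, TangentBundle.symmL_trivializationAt hzs,
    (extChartAt (𝓡 n) x).right_inv hzt] at key
  exact key

/-- The straight segment in the chart stays in the convex ball, where the inverse chart stretches
lengths by at most `2`; its image is a path from `x` to `y`. This converts the support of a bump in
the chart into a small metric ball. -/
theorem edist_le_of_extChartAt [IsRiemannianManifold (𝓡 n) M] (x : M) :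
    ∃ r > 0, ∀ y ∈ (chartAt (EuclideanSpace ℝ (Fin n)) x).source,
      extChartAt (𝓡 n) x y ∈ Metric.ball (extChartAt (𝓡 n) x x) r →
      edist x y ≤ 2 * ‖modelToTangent x (extChartAt (𝓡 n) x y - extChartAt (𝓡 n) x x)‖ₑ := by
  obtain ⟨r, r_pos, hr⟩ := Metric.mem_nhds_iff.1
    (inter_mem (extChartAt_target_mem_nhds (I := 𝓡 n) x) (eventually_norm_mfderiv_symm_le x))
  refine ⟨r, r_pos, fun y h'y hy => ?_⟩
  let η := ContinuousAffineMap.lineMap (R := ℝ) (extChartAt (𝓡 n) x x) (extChartAt (𝓡 n) x y)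
  set γ := (extChartAt (𝓡 n) x).symm ∘ η
  have hη : ∀ t ∈ Icc (0 : ℝ) 1, η t ∈ Metric.ball (extChartAt (𝓡 n) x x) r := by
    intro t ht
    have : η t ∈ segment ℝ (extChartAt (𝓡 n) x x) (extChartAt (𝓡 n) x y) := by
      rw [segment_eq_image_lineMap]
      exact ⟨t, ht, rfl⟩
    exact (convex_ball _ _).segment_subset (by simp [r_pos]) hy this
  have hηt : Icc (0 : ℝ) 1 ⊆ η ⁻¹' (extChartAt (𝓡 n) x).target := fun t ht => (hr (hη t ht)).1
  have η_smooth : ContMDiffOn 𝓘(ℝ, ℝ) 𝓘(ℝ, EuclideanSpace ℝ (Fin n)) 1 η (Icc 0 1) := by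
    apply ContMDiff.contMDiffOn
    rw [contMDiff_iff_contDiff]
    exact ContinuousAffineMap.contDiff _
  have hle : Manifold.riemannianEDist (𝓡 n) x y ≤ Manifold.pathELength (𝓡 n) γ 0 1 := by
    apply Manifold.riemannianEDist_le_pathELength _ _ _ zero_le_one
    · exact (contMDiffOn_extChartAt_symm x).comp η_smooth hηt
    · simp [γ, η, ContinuousAffineMap.coe_lineMap_eq]
    · have : (extChartAt (𝓡 n) x).symm (extChartAt (𝓡 n) x y) = y :=
        (extChartAt (𝓡 n) x).left_inv (by simpa using h'y)
      simpa [γ, η, ContinuousAffineMap.coe_lineMap_eq] using this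
  rw [IsRiemannianManifold.out (I := 𝓡 n) x y]
  refine hle.trans ?_
  rw [Manifold.pathELength_eq_lintegral_mfderivWithin_Icc]
  have hconst : ∫⁻ _ in Icc (0 : ℝ) 1,
      2 * ‖modelToTangent x (extChartAt (𝓡 n) x y - extChartAt (𝓡 n) x x)‖ₑ =
      2 * ‖modelToTangent x (extChartAt (𝓡 n) x y - extChartAt (𝓡 n) x x)‖ₑ := by simp
  rw [← hconst]
  refine setLIntegral_mono' measurableSet_Icc fun t ht => ?_
  have huniq : UniqueDiffWithinAt ℝ (Icc (0 : ℝ) 1) t := uniqueDiffOn_Icc zero_lt_one t ht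
  have h1 : mfderivWithin 𝓘(ℝ, ℝ) (𝓡 n) γ (Icc 0 1) t =
      (mfderivWithin 𝓘(ℝ, EuclideanSpace ℝ (Fin n)) (𝓡 n) (extChartAt (𝓡 n) x).symm
        (range (𝓡 n)) (η t)) ∘L
      (mfderivWithin 𝓘(ℝ, ℝ) 𝓘(ℝ, EuclideanSpace ℝ (Fin n)) η (Icc 0 1) t) := by
    apply mfderivWithin_comp
    · exact mdifferentiableWithinAt_extChartAt_symm (hηt ht)
    · exact η_smooth.mdifferentiableOn one_ne_zero t ht
    · exact hηt.trans (preimage_mono (extChartAt_target_subset_range x))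
    · rw [uniqueMDiffWithinAt_iff_uniqueDiffWithinAt]
      exact huniq
  have h2 : mfderivWithin 𝓘(ℝ, ℝ) 𝓘(ℝ, EuclideanSpace ℝ (Fin n)) η (Icc 0 1) t (1 : ℝ) =
      (extChartAt (𝓡 n) x y - extChartAt (𝓡 n) x x : EuclideanSpace ℝ (Fin n)) := by
    rw [mfderivWithin_eq_fderivWithin,
      fderivWithin_eq_fderiv huniq (ContinuousAffineMap.differentiableAt _)]
    have : ∀ a b : EuclideanSpace ℝ (Fin n),
        fderiv ℝ (ContinuousAffineMap.lineMap (R := ℝ) a b) t 1 = b - a := fun a b => by simp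
    exact this _ _
  have h3 : mfderivWithin 𝓘(ℝ, ℝ) (𝓡 n) γ (Icc 0 1) t (1 : ℝ) =
      (mfderivWithin 𝓘(ℝ, EuclideanSpace ℝ (Fin n)) (𝓡 n) (extChartAt (𝓡 n) x).symm
        (range (𝓡 n)) (η t)) (extChartAt (𝓡 n) x y - extChartAt (𝓡 n) x x) := by
    rw [← h2]
    exact congr($h1 (1 : ℝ))
  have h4 := (hr (hη t ht)).2 (extChartAt (𝓡 n) x y - extChartAt (𝓡 n) x x)
  have h5 := ENNReal.ofReal_le_ofReal h4
  rw [ENNReal.ofReal_mul (by norm_num), ofReal_norm, ofReal_norm] at h5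
  refine le_trans (le_of_eq ?_) (h5.trans_eq (by simp))
  exact congrArg _ h3

omit [IsContinuousRiemannianBundle (EuclideanSpace ℝ (Fin n)) fun x : M => TangentSpace (𝓡 n) x] in
theorem exists_norm_le_modelToTangent (x : M) :
    ∃ K : ℝ, 0 < K ∧ ∀ w : EuclideanSpace ℝ (Fin n), ‖w‖ ≤ K * ‖modelToTangent x w‖ := by
  have hx := FiberBundle.mem_baseSet_trivializationAt' (F := EuclideanSpace ℝ (Fin n))
    (E := fun x : M => TangentSpace (𝓡 n) x) x
  have hinj : Function.Injective (modelToTangent (n := n) x) := Function.LeftInverse.injective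
    (g := (trivializationAt (EuclideanSpace ℝ (Fin n)) (fun x : M => TangentSpace (𝓡 n) x)
      x).continuousLinearMapAt ℝ x) fun w => Trivialization.continuousLinearMapAt_symmL _ hx w
  obtain ⟨K, hK, h⟩ := (modelToTangent (n := n) x).exists_antilipschitzWith
    (LinearMap.ker_eq_bot.2 hinj)
  exact ⟨K, by exact_mod_cast hK, fun w => by simpa using h.le_mul_dist w 0⟩

/-- Around each point there are bump functions supported in arbitrarily small balls, whose
gradients are bounded by a constant when their heights are twice the radii of the balls. -/
theorem exists_bump [IsRiemannianManifold (𝓡 n) M] : ∃ Λ : ℝ, 0 ≤ Λ ∧ ∀ x : M, ∃ r > 0, ∀ s : ℝ,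
    0 < s → s < r → ∃ b : M → ℝ, ContMDiff (𝓡 n) 𝓘(ℝ, ℝ) ∞ b ∧ (∀ y, 0 ≤ b y) ∧ b x = 2 * s ∧
      (∀ y, b y ≠ 0 → edist x y ≤ ENNReal.ofReal s) ∧
      ∀ (y : M) (v : TangentSpace (𝓡 n) y), |mvfderiv (𝓡 n) b y v| ≤ Λ * ‖v‖ := by
  obtain ⟨Λ, hΛ, H⟩ := exists_bump_of_linear
  refine ⟨2 * Λ, by positivity, fun x => ?_⟩
  let φ := extChartAt (𝓡 n) x
  obtain ⟨r₁, hr₁, hdist⟩ := edist_le_of_extChartAt (n := n) x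
  obtain ⟨K, hK, hKle⟩ := exists_norm_le_modelToTangent (n := n) x
  have h2 : 𝓝 x = 𝓝 (φ.symm (φ x)) := by simp [φ]
  have hsymm := (continuousAt_extChartAt_symm (I := 𝓡 n) x).eventually
    (h2 ▸ eventually_norm_modelToTangent_mfderiv_le (n := n) x)
  obtain ⟨r₂, hr₂, hr₂'⟩ := Metric.mem_nhds_iff.1
    (inter_mem (extChartAt_target_mem_nhds (I := 𝓡 n) x) hsymm)
  refine ⟨min r₁ r₂ / K, by positivity, fun s hs hsr => ?_⟩
  -- With `ρ = s / 2`, the height is `4ρ = 2s`, and the factor `2` of `edist_le_of_extChartAt` puts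
  -- the support into the ball of radius `s`.
  obtain ⟨h, hsm, hnn, hx, hsupp, hder⟩ := H (EuclideanSpace ℝ (Fin n)) (TangentSpace (𝓡 n) x)
    (modelToTangent x) (φ x) (s / 2) (by positivity)
  have hball : ∀ z, ‖modelToTangent x (z - φ x)‖ ≤ s / 2 → z ∈ Metric.ball (φ x) (min r₁ r₂) := by
    intro z hz
    rw [Metric.mem_ball, dist_eq_norm]
    calc ‖z - φ x‖ ≤ K * ‖modelToTangent x (z - φ x)‖ := hKle _
      _ ≤ K * (s / 2) := by gcongr
      _ < K * (min r₁ r₂ / K) := mul_lt_mul_of_pos_left (by linarith) hK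
      _ = min r₁ r₂ := by field_simp
  set Q : Set (EuclideanSpace ℝ (Fin n)) := {z | ‖modelToTangent x (z - φ x)‖ ≤ s / 2} with hQ
  have hQt : Q ⊆ φ.target := fun z hz =>
    (hr₂' (Metric.ball_subset_ball (min_le_right _ _) (hball z hz))).1
  have hQc : IsCompact Q := by
    refine Metric.isCompact_of_isClosed_isBounded ?_
      (Metric.isBounded_ball.subset fun z hz => hball z hz)
    exact isClosed_le (((modelToTangent x).continuous.comp
      (continuous_id.sub continuous_const)).norm) continuous_const
  have hKc : IsCompact (φ.symm '' Q) :=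
    hQc.image_of_continuousOn ((continuousOn_extChartAt_symm (I := 𝓡 n) x).mono hQt)
  classical
  -- Extension by zero is smooth because `b` vanishes off the image of `Q`, a compact and hence
  -- closed subset of the chart domain.
  set b : M → ℝ := φ.source.indicator fun y => h (φ y) with hb
  have hsrc : IsOpen φ.source := isOpen_extChartAt_source x
  have hbin : ∀ y ∈ φ.source, b =ᶠ[𝓝 y] fun y => h (φ y) := fun y hy =>
    (hsrc.eventually_mem hy).mono fun z hz => indicator_of_mem hz _
  have hbne : ∀ y, b y ≠ 0 → y ∈ φ.source ∧ φ y ∈ Q := by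
    intro y hy
    have hys : y ∈ φ.source := by
      by_contra hys
      exact hy (indicator_of_notMem hys _)
    refine ⟨hys, hsupp _ ?_⟩
    rwa [hb, indicator_of_mem hys] at hy
  have hbout : ∀ y ∉ φ.symm '' Q, b =ᶠ[𝓝 y] fun _ => 0 := by
    intro y hy
    filter_upwards [hKc.isClosed.isOpen_compl.eventually_mem hy] with z hz
    by_contra hbz
    exact hz ⟨φ z, (hbne z hbz).2, φ.left_inv (hbne z hbz).1⟩
  have hφ : ContMDiffOn (𝓡 n) 𝓘(ℝ, EuclideanSpace ℝ (Fin n)) ∞ φ φ.source := by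
    simpa [φ] using contMDiffOn_extChartAt (I := 𝓡 n) (x := x) (n := ∞)
  refine ⟨b, fun y => ?_, fun y => ?_, ?_, fun y hy => ?_, fun y v => ?_⟩
  · by_cases hy : y ∈ φ.source
    · exact (hsm.contMDiff.contMDiffAt.comp y (hφ.contMDiffAt (hsrc.mem_nhds hy))).congr_of_eventuallyEq
        (hbin y hy)
    · refine contMDiffAt_const.congr_of_eventuallyEq (hbout y ?_)
      rintro ⟨z, hz, rfl⟩
      exact hy (φ.map_target (hQt hz))
  · exact indicator_nonneg (fun z _ => hnn _) y
  · rw [hb, indicator_of_mem (mem_extChartAt_source x), hx]; ring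
  · obtain ⟨hys, hyQ⟩ := hbne y hy
    refine (hdist y (by simpa [φ] using hys)
      (Metric.ball_subset_ball (min_le_left _ _) (hball _ hyQ))).trans ?_
    have := ENNReal.ofReal_le_ofReal (show 2 * ‖modelToTangent x (φ y - φ x)‖ ≤ s by
      have : ‖modelToTangent x (φ y - φ x)‖ ≤ s / 2 := hyQ
      linarith)
    rw [ENNReal.ofReal_mul (by norm_num), ofReal_norm, ENNReal.ofReal_ofNat] at this
    exact this
  · by_cases hy : y ∈ φ.symm '' Q
    · obtain ⟨z, hz, rfl⟩ := hy
      have hzt := hQt hz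
      have hys : φ.symm z ∈ φ.source := φ.map_target hzt
      have hzφ : φ (φ.symm z) = z := φ.right_inv hzt
      have hd : mvfderiv (𝓡 n) b (φ.symm z) v = fderiv ℝ h (φ (φ.symm z))
          (mfderiv (𝓡 n) 𝓘(ℝ, EuclideanSpace ℝ (Fin n)) φ (φ.symm z) v) := by
        have h1 : mfderiv (𝓡 n) 𝓘(ℝ, ℝ) b (φ.symm z) =
            mfderiv (𝓡 n) 𝓘(ℝ, ℝ) (h ∘ φ) (φ.symm z) := (hbin _ hys).mfderiv_eq
        have h2 : mfderiv (𝓡 n) 𝓘(ℝ, ℝ) (h ∘ φ) (φ.symm z) =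
            (mfderiv 𝓘(ℝ, EuclideanSpace ℝ (Fin n)) 𝓘(ℝ, ℝ) h (φ (φ.symm z))).comp
              (mfderiv (𝓡 n) 𝓘(ℝ, EuclideanSpace ℝ (Fin n)) φ (φ.symm z)) :=
          mfderiv_comp _ (hsm.contMDiff.mdifferentiable (by simp) _)
            ((hφ.contMDiffAt (hsrc.mem_nhds hys)).mdifferentiableAt (by simp))
        rw [mfderiv_eq_fderiv] at h2
        exact congr($(h1.trans h2) v)
      rw [hd]
      refine (hder _ _).trans ?_
      have := (hr₂' (Metric.ball_subset_ball (min_le_right _ _) (hball z hz))).2 v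
      calc Λ * _ ≤ Λ * (2 * ‖v‖) := mul_le_mul_of_nonneg_left this hΛ
        _ = 2 * Λ * ‖v‖ := by ring
    · have : mvfderiv (𝓡 n) b y v = 0 := by
        have h1 : mfderiv (𝓡 n) 𝓘(ℝ, ℝ) b y = 0 := by
          have := (hbout y hy).mfderiv_eq (I := 𝓡 n) (I' := 𝓘(ℝ, ℝ))
          exact this.trans mfderiv_const
        rw [mvfderiv, h1]
        rfl
      rw [this, abs_zero]
      positivity

end Chart

end RiemannianSobolev

namespace RiemannianSobolev

/-! ### Smooth cutoff functions with small gradient on a complete set -/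

section Truncation

/-- A smooth truncation at the level `R`. -/
theorem exists_smooth_truncation {R R₁ : ℝ} (hR : 0 ≤ R) (hR₁ : R < R₁) :
    ∃ P : ℝ → ℝ, ContDiff ℝ ∞ P ∧ (∀ t, 0 ≤ deriv P t) ∧ (∀ t, deriv P t ≤ 1) ∧
      (∀ t, t ≤ 0 → P t ≤ 0) ∧ (∀ t, R₁ ≤ t → R ≤ P t) ∧ ∀ t, R₁ ≤ t → deriv P t = 0 := by
  set σ : ℝ → ℝ := fun u => Real.smoothTransition ((R₁ - u) / (R₁ - R)) with hσ
  have hσs : ContDiff ℝ ∞ σ :=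
    Real.smoothTransition.contDiff.comp ((contDiff_const.sub contDiff_id).div_const _)
  -- The density `σ` is `1` below `R` and `0` above `R₁`, so `P` is the identity on `[0, R]` and
  -- constant beyond `R₁`.
  set P : ℝ → ℝ := fun t => ∫ u in (0 : ℝ)..t, σ u with hP
  have hder : ∀ t, HasDerivAt P (σ t) t := fun t => hσs.continuous.integral_hasStrictDerivAt 0 t
    |>.hasDerivAt
  have hderiv : deriv P = σ := funext fun t => (hder t).deriv
  have hdiff : Differentiable ℝ P := fun t => (hder t).differentiableAt
  have hmono : Monotone P := monotone_of_deriv_nonneg hdiff fun t => by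
    rw [hderiv]; exact Real.smoothTransition.nonneg _
  have hP0 : P 0 = 0 := by simp [hP]
  refine ⟨P, contDiff_infty_iff_deriv.2 ⟨hdiff, hderiv ▸ hσs⟩, fun t => ?_, fun t => ?_,
    fun t ht => hP0 ▸ hmono ht, fun t ht => ?_, fun t ht => ?_⟩
  · rw [hderiv]; exact Real.smoothTransition.nonneg _
  · rw [hderiv]; exact Real.smoothTransition.le_one _
  · refine le_trans (le_of_eq ?_) (hmono (hR₁.le.trans ht))
    have : P R = ∫ u in (0 : ℝ)..R, (1 : ℝ) := by
      refine intervalIntegral.integral_congr fun u hu => ?_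
      rw [uIcc_of_le hR] at hu
      refine Real.smoothTransition.one_of_one_le ?_
      rw [le_div_iff₀ (by linarith)]
      linarith [hu.2]
    rw [this]
    simp
  · rw [hderiv]
    exact Real.smoothTransition.zero_of_nonpos
      (div_nonpos_of_nonpos_of_nonneg (by linarith) (by linarith))

/-- A smooth version of the positive part, up to a small error. -/
theorem exists_smooth_posPart {ε : ℝ} (hε : 0 < ε) :
    ∃ P : ℝ → ℝ, ContDiff ℝ ∞ P ∧ (∀ t, 0 ≤ deriv P t) ∧ (∀ t, deriv P t ≤ 1) ∧
      (∀ t, max t 0 - ε ≤ P t) ∧ ∀ t, P t ≤ max t 0 := by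
  have hpos : ∀ t : ℝ, 0 < t ^ 2 + (2 * ε) ^ 2 := fun t => by positivity
  have habs : ∀ t : ℝ, |t| ≤ √(t ^ 2 + (2 * ε) ^ 2) := fun t =>
    Real.abs_le_sqrt (by nlinarith)
  have hder : ∀ t, HasDerivAt (fun t => (t + √(t ^ 2 + (2 * ε) ^ 2)) / 2 - ε)
      ((1 + t / √(t ^ 2 + (2 * ε) ^ 2)) / 2) t := by
    intro t
    have h1 : HasDerivAt (fun t : ℝ => t ^ 2 + (2 * ε) ^ 2) (2 * t) t := by
      simpa using (hasDerivAt_pow 2 t).add_const ((2 * ε) ^ 2)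
    have h2 := ((((hasDerivAt_id t).add (h1.sqrt (hpos t).ne')).div_const 2).sub_const ε)
    refine h2.congr_deriv ?_
    congr 2
    rw [mul_div_mul_left _ _ two_ne_zero]
  -- The hyperbola lies between the positive part and the positive part plus `ε`; subtracting `ε`
  -- places it below, so nonpositivity on `K` will survive.
  refine ⟨fun t => (t + √(t ^ 2 + (2 * ε) ^ 2)) / 2 - ε, ?_, fun t => ?_, fun t => ?_, fun t => ?_,
    fun t => ?_⟩
  · refine ((contDiff_id.add (ContDiff.sqrt ?_ fun t => (hpos t).ne')).div_const 2).sub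
      contDiff_const
    exact (contDiff_id.pow 2).add contDiff_const
  · rw [(hder t).deriv]
    have : -1 ≤ t / √(t ^ 2 + (2 * ε) ^ 2) := by
      rw [le_div_iff₀ (Real.sqrt_pos.2 (hpos t))]
      linarith [habs t, neg_abs_le t]
    linarith
  · rw [(hder t).deriv]
    have : t / √(t ^ 2 + (2 * ε) ^ 2) ≤ 1 := by
      rw [div_le_one (Real.sqrt_pos.2 (hpos t))]
      linarith [habs t, le_abs_self t]
    linarith
  · rcases max_cases t 0 with ⟨h, -⟩ | ⟨h, -⟩ <;> rw [h] <;>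
      linarith [habs t, le_abs_self t, neg_abs_le t]
  · have h1 : √(t ^ 2 + (2 * ε) ^ 2) ≤ |t| + 2 * ε := by
      rw [Real.sqrt_le_left (by positivity)]
      nlinarith [sq_abs t, abs_nonneg t]
    rcases le_total t 0 with h | h
    · rw [max_eq_right h]; rw [abs_of_nonpos h] at h1; linarith
    · rw [max_eq_left h]; rw [abs_of_nonneg h] at h1; linarith

end Truncation

section Differential

variable {n : ℕ} {M : Type*} [TopologicalSpace M] [ChartedSpace (EuclideanSpace ℝ (Fin n)) M]

theorem mvfderiv_real_comp_apply {P : ℝ → ℝ} {g : M → ℝ} {y : M}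
    (hP : DifferentiableAt ℝ P (g y)) (hg : MDifferentiableAt (𝓡 n) 𝓘(ℝ, ℝ) g y)
    (v : TangentSpace (𝓡 n) y) :
    mvfderiv (𝓡 n) (fun z => P (g z)) y v = deriv P (g y) * mvfderiv (𝓡 n) g y v := by
  have h1 : mfderiv (𝓡 n) 𝓘(ℝ, ℝ) (P ∘ g) y =
      (mfderiv 𝓘(ℝ, ℝ) 𝓘(ℝ, ℝ) P (g y)).comp (mfderiv (𝓡 n) 𝓘(ℝ, ℝ) g y) :=
    mfderiv_comp y hP.mdifferentiableAt hg
  rw [mfderiv_eq_fderiv] at h1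
  have h2 : mvfderiv (𝓡 n) (fun z => P (g z)) y v = fderiv ℝ P (g y) (mvfderiv (𝓡 n) g y v) :=
    congr($h1 v)
  rw [h2, fderiv_eq_smul_deriv, smul_eq_mul, mul_comm]

theorem mvfderiv_congr_of_eventuallyEq {g g' : M → ℝ} {y : M} (h : g =ᶠ[𝓝 y] g')
    (v : TangentSpace (𝓡 n) y) : mvfderiv (𝓡 n) g y v = mvfderiv (𝓡 n) g' y v := by
  have h1 : mfderiv (𝓡 n) 𝓘(ℝ, ℝ) g y = mfderiv (𝓡 n) 𝓘(ℝ, ℝ) g' y := h.mfderiv_eq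
  exact congr($h1 v)

/-- A zero of a nonnegative function is a minimum. Thus the gradient of a bump or a cutoff vanishes
at each of its zeros, with no discussion of supports. -/
theorem mvfderiv_eq_zero_of_nonneg {g : M → ℝ} {y : M}
    (hg : MDifferentiableAt (𝓡 n) 𝓘(ℝ, ℝ) g y) (hnn : ∀ z, 0 ≤ g z) (hy : g y = 0)
    (v : TangentSpace (𝓡 n) y) : mvfderiv (𝓡 n) g y v = 0 := by
  have hmin : IsLocalMin (writtenInExtChartAt (𝓡 n) 𝓘(ℝ, ℝ) y g) (extChartAt (𝓡 n) y y) :=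
    Filter.Eventually.of_forall fun z => by
      change g ((extChartAt (𝓡 n) y).symm (extChartAt (𝓡 n) y y)) ≤
        g ((extChartAt (𝓡 n) y).symm z)
      rw [extChartAt_to_inv, hy]
      exact hnn _
  have h := hg.mvfderiv
  have hr : range (𝓡 n) = univ := by simp
  rw [hr, fderivWithin_univ, hmin.fderiv_eq_zero] at h
  exact congr($h v)

end Differential

/-! ### A substitute for the distance function, defined by gradient bounds on `A` -/

section Cutoff

open scoped NNReal

variable {n : ℕ} {M : Type*} [EMetricSpace M] [ChartedSpace (EuclideanSpace ℝ (Fin n)) M]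
  [RiemannianBundle (fun x : M => TangentSpace (𝓡 n) x)]

variable (n) in
/-- The smooth functions which are nonpositive on `K` and whose gradient is bounded by `Λ` on `A`.
-/
structure IsTestFunction (A K : Set M) (Λ : ℝ) (g : M → ℝ) : Prop where
  contMDiff : ContMDiff (𝓡 n) 𝓘(ℝ, ℝ) ∞ g
  nonpos : ∀ y ∈ K, g y ≤ 0
  gradient_le : ∀ y ∈ A, ∀ v : TangentSpace (𝓡 n) y, |mvfderiv (𝓡 n) g y v| ≤ Λ * ‖v‖

variable (n) in
/-- The supremum of the test functions: a kind of distance to `K` in the set `A`. -/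
def testSup (A K : Set M) (Λ : ℝ) (x : M) : ℝ≥0∞ :=
  ⨆ (g : M → ℝ) (_ : IsTestFunction n A K Λ g), ENNReal.ofReal (g x)

variable {A K : Set M} {Λ : ℝ}

theorem IsTestFunction.mdifferentiableAt {g : M → ℝ} (hg : IsTestFunction n A K Λ g) (y : M) :
    MDifferentiableAt (𝓡 n) 𝓘(ℝ, ℝ) g y :=
  hg.contMDiff.mdifferentiable (by simp) y

theorem IsTestFunction.le_testSup {g : M → ℝ} (hg : IsTestFunction n A K Λ g) (x : M) :
    ENNReal.ofReal (g x) ≤ testSup n A K Λ x :=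
  le_iSup₂ (f := fun (g : M → ℝ) (_ : IsTestFunction n A K Λ g) => ENNReal.ofReal (g x)) g hg

theorem lowerSemicontinuous_testSup : LowerSemicontinuous (testSup n A K Λ) :=
  lowerSemicontinuous_biSup fun _ hg =>
    (ENNReal.continuous_ofReal.comp hg.contMDiff.continuous).lowerSemicontinuous

theorem exists_lt_of_lt_testSup {R : ℝ} (hR : 0 ≤ R) {x : M}
    (h : ENNReal.ofReal R < testSup n A K Λ x) : ∃ g, IsTestFunction n A K Λ g ∧ R < g x := by
  obtain ⟨g, hg⟩ := lt_iSup_iff.1 h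
  obtain ⟨hgt, hg⟩ := lt_iSup_iff.1 hg
  exact ⟨g, hgt, (ENNReal.ofReal_lt_ofReal_iff_of_nonneg hR).1 hg⟩

theorem testSup_eq_zero {x : M} (hx : x ∈ K) : testSup n A K Λ x = 0 := by
  simp only [testSup, ENNReal.iSup_eq_zero, ENNReal.ofReal_eq_zero]
  exact fun g hg => hg.nonpos x hx

theorem isTestFunction_const {c : ℝ} (hc : c ≤ 0) (hΛ : 0 ≤ Λ) :
    IsTestFunction n A K Λ fun _ => c where
  contMDiff := contMDiff_const
  nonpos := fun _ _ => hc
  gradient_le := fun y _ v => by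
    rw [mvfderiv_const]
    simp only [_root_.zero_apply, abs_zero]
    positivity

/-- The smooth maximum `g₂ + P(g₁ - g₂)` has differential `p dg₁ + (1 - p) dg₂` with `0 ≤ p ≤ 1`, so
the bound `Λ` is kept exactly. -/
theorem IsTestFunction.exists_max {g₁ g₂ : M → ℝ} (h₁ : IsTestFunction n A K Λ g₁)
    (h₂ : IsTestFunction n A K Λ g₂) {ε : ℝ} (hε : 0 < ε) :
    ∃ g, IsTestFunction n A K Λ g ∧ ∀ x, max (g₁ x) (g₂ x) - ε ≤ g x := by
  obtain ⟨P, hP, hP0, hP1, hPge, hPle⟩ := exists_smooth_posPart hε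
  have hmax : ∀ a b : ℝ, b + max (a - b) 0 = max a b := fun a b => by
    rw [← max_add_add_left]; simp
  refine ⟨fun x => g₂ x + P (g₁ x - g₂ x), ⟨?_, fun y hy => ?_, fun y hy v => ?_⟩, fun x => ?_⟩
  · exact h₂.contMDiff.add (hP.contMDiff.comp (h₁.contMDiff.sub h₂.contMDiff))
  · have := hPle (g₁ y - g₂ y)
    have h3 := hmax (g₁ y) (g₂ y)
    have := max_le (h₁.nonpos y hy) (h₂.nonpos y hy)
    linarith
  · have hd1 := h₁.mdifferentiableAt y
    have hd2 := h₂.mdifferentiableAt y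
    have hd : MDifferentiableAt (𝓡 n) 𝓘(ℝ, ℝ) (fun x => g₁ x - g₂ x) y := hd1.sub hd2
    have hPd : DifferentiableAt ℝ P (g₁ y - g₂ y) := (hP.differentiable (by simp)).differentiableAt
    have hPc : MDifferentiableAt (𝓡 n) 𝓘(ℝ, ℝ) (fun x => P (g₁ x - g₂ x)) y :=
      hPd.mdifferentiableAt.comp y hd
    rw [mvfderiv_fun_add hd2 hPc, _root_.add_apply,
      mvfderiv_real_comp_apply (g := fun x => g₁ x - g₂ x) hPd hd,
      mvfderiv_fun_sub hd1 hd2, _root_.sub_apply]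
    have e1 := abs_le.1 (h₁.gradient_le y hy v)
    have e2 := abs_le.1 (h₂.gradient_le y hy v)
    have p0 := hP0 (g₁ y - g₂ y)
    have p1 := hP1 (g₁ y - g₂ y)
    set p := deriv P (g₁ y - g₂ y)
    rw [abs_le]
    constructor <;> nlinarith
  · have := hPge (g₁ x - g₂ x)
    have h3 := hmax (g₁ x) (g₂ x)
    linarith

/-- If a compact set is covered by the sets `{g > R}`, then one test function is larger than `R`
on this set. -/
theorem exists_isTestFunction_of_isCompact (hΛ : 0 ≤ Λ) {R : ℝ} {C : Set M} (hC : IsCompact C)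
    (h : ∀ x ∈ C, ∃ g, IsTestFunction n A K Λ g ∧ R < g x) :
    ∃ g, IsTestFunction n A K Λ g ∧ ∃ η > 0, ∀ x ∈ C, R + η ≤ g x := by
  refine hC.induction_on (p := fun C => ∃ g, IsTestFunction n A K Λ g ∧ ∃ η > 0, ∀ x ∈ C,
    R + η ≤ g x) ⟨_, isTestFunction_const le_rfl hΛ, 1, one_pos, by simp⟩ ?_ ?_ ?_
  · rintro s t hst ⟨g, hg, η, hη, h⟩
    exact ⟨g, hg, η, hη, fun x hx => h x (hst hx)⟩
  · rintro s t ⟨g, hg, η, hη, h⟩ ⟨g', hg', η', hη', h'⟩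
    -- Each smooth maximum costs a small error, which is taken from the margin `η`; this is why the
    -- induction carries a margin.
    obtain ⟨G, hG, hGle⟩ := hg.exists_max hg' (half_pos (lt_min hη hη'))
    refine ⟨G, hG, min η η' / 2, half_pos (lt_min hη hη'), ?_⟩
    rintro x (hx | hx)
    · have := hGle x
      linarith [h x hx, le_max_left (g x) (g' x), min_le_left η η']
    · have := hGle x
      linarith [h' x hx, le_max_right (g x) (g' x), min_le_right η η']
  · intro x hx
    obtain ⟨g, hg, hgx⟩ := h x hx
    refine ⟨{y | R + (g x - R) / 2 < g y}, mem_nhdsWithin_of_mem_nhds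
      (hg.contMDiff.continuous.continuousAt.eventually (lt_mem_nhds (by linarith))), g, hg,
      (g x - R) / 2, by linarith, fun y hy => le_of_lt hy⟩

/-- The property of the constant `Λ` provided by `exists_bump`. -/
def HasBumps (n : ℕ) (M : Type*) [EMetricSpace M] [ChartedSpace (EuclideanSpace ℝ (Fin n)) M]
    [RiemannianBundle (fun x : M => TangentSpace (𝓡 n) x)] (Λ : ℝ) : Prop :=
  ∀ x : M, ∃ r > 0, ∀ s : ℝ, 0 < s → s < r →
    ∃ b : M → ℝ, ContMDiff (𝓡 n) 𝓘(ℝ, ℝ) ∞ b ∧ (∀ y, 0 ≤ b y) ∧ b x = 2 * s ∧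
      (∀ y, b y ≠ 0 → edist x y ≤ ENNReal.ofReal s) ∧
      ∀ (y : M) (v : TangentSpace (𝓡 n) y), |mvfderiv (𝓡 n) b y v| ≤ Λ * ‖v‖

theorem testSup_pos_of_notMem (hb : HasBumps n M Λ) (hK : IsClosed K) {x : M} (hx : x ∉ K) :
    0 < testSup n A K Λ x := by
  obtain ⟨r, hr, H⟩ := hb x
  obtain ⟨ε, hε, hεK⟩ := EMetric.mem_nhds_iff.1 (hK.isOpen_compl.mem_nhds hx)
  obtain ⟨δ, hδ0, hδ⟩ := ENNReal.lt_iff_exists_nnreal_btwn.1 hε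
  have hδ0' : (0 : ℝ) < δ := by exact_mod_cast hδ0
  obtain ⟨s, hs0, hs⟩ := exists_between (lt_min hr hδ0')
  obtain ⟨b, hbs, hbn, hbx, hsupp, hgrad⟩ := H s hs0 (hs.trans_le (min_le_left _ _))
  have hbt : IsTestFunction n A K Λ b := ⟨hbs, fun y hy => ?_, fun y _ v => hgrad y v⟩
  · refine lt_of_lt_of_le ?_ (hbt.le_testSup x)
    rw [hbx, ENNReal.ofReal_pos]
    positivity
  · by_contra! hlt
    refine hεK ?_ hy
    rw [Metric.mem_eball']
    refine (hsupp y hlt.ne').trans_lt (lt_trans ?_ hδ)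
    rw [← ENNReal.ofReal_coe_nnreal]
    exact (ENNReal.ofReal_lt_ofReal_iff hδ0').2 (hs.trans_le (min_le_right _ _))

/-- If the slope at `x` were too small, `testSup` would exceed `testSup x - s` on the whole of `A ∩
B`, with `B` the ball of radius `s` about `x`. A single test function is then that large on this
compact set; flattened there and raised by a bump of height `2s`, it reaches at least `testSup x +
s` at `x`, which is absurd. -/
theorem testSup_slope [LocallyCompactSpace M] (hb : HasBumps n M Λ) (hΛ : 0 ≤ Λ) (hA : IsClosed A)
    (hKA : K ⊆ A) (R : ℝ≥0) {x : M} (hxA : x ∈ A) (hR : R < testSup n A K Λ x)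
    (hfin : testSup n A K Λ x ≠ ⊤) :
    ∃ y ∈ A, y ≠ x ∧ max (testSup n A K Λ y) R + edist x y ≤ testSup n A K Λ x := by
  set f := testSup n A K Λ with hf
  by_contra! hcon
  obtain ⟨a, ha⟩ : ∃ a : ℝ≥0, f x = a := ⟨(f x).toNNReal, (ENNReal.coe_toNNReal hfin).symm⟩
  rw [ha] at hcon hR
  have hRa : (R : ℝ) < a := by exact_mod_cast hR
  obtain ⟨r, hr, H⟩ := hb x
  obtain ⟨N, hN, hxN⟩ := exists_compact_mem_nhds x
  obtain ⟨ε, hε, hεN⟩ := EMetric.mem_nhds_iff.1 hxN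
  obtain ⟨δ, hδ0, hδ⟩ := ENNReal.lt_iff_exists_nnreal_btwn.1 hε
  have hδ0' : (0 : ℝ) < δ := by exact_mod_cast hδ0
  obtain ⟨s, hs0, hs⟩ := exists_between (lt_min (lt_min hr hδ0') (sub_pos.2 hRa))
  have hsr : s < r := hs.trans_le ((min_le_left _ _).trans (min_le_left _ _))
  have hsδ : s < δ := hs.trans_le ((min_le_left _ _).trans (min_le_right _ _))
  have hsR : s < a - R := hs.trans_le (min_le_right _ _)
  obtain ⟨b, hbs, hbn, hbx, hsupp, hgrad⟩ := H s hs0 hsr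
  set B : Set M := {y | edist x y ≤ ENNReal.ofReal s} with hB
  have hBcl : IsClosed B := isClosed_le (continuous_const.edist continuous_id) continuous_const
  have hBc : IsCompact B := by
    refine hN.of_isClosed_subset hBcl fun y hy => hεN ?_
    rw [Metric.mem_eball']
    refine lt_of_le_of_lt hy (lt_trans ?_ hδ)
    rw [← ENNReal.ofReal_coe_nnreal]
    exact (ENNReal.ofReal_lt_ofReal_iff hδ0').2 hsδ
  set l : ℝ := a - s with hl
  have hl0 : 0 ≤ l := by have := R.2; simp only [hl]; linarith [R.coe_nonneg]
  have hlow : ∀ y ∈ A ∩ B, ENNReal.ofReal l < f y := by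
    rintro y ⟨hyA, hyB⟩
    rcases eq_or_ne y x with rfl | hne
    · rw [ha, ← ENNReal.ofReal_coe_nnreal]
      exact (ENNReal.ofReal_lt_ofReal_iff (lt_of_le_of_lt hl0 (by simp [hl, hs0]))).2
        (by simp [hl, hs0])
    · by_contra! hle
      have h1 := hcon y hyA hne
      have h2 : max (f y) R ≤ ENNReal.ofReal l := max_le hle (by
        rw [← ENNReal.ofReal_coe_nnreal]
        exact ENNReal.ofReal_le_ofReal (by simp only [hl]; linarith))
      have h3 : max (f y) R + edist x y ≤ ENNReal.ofReal l + ENNReal.ofReal s := add_le_add h2 hyB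
      rw [← ENNReal.ofReal_add hl0 hs0.le, show l + s = a by simp [hl],
        ENNReal.ofReal_coe_nnreal] at h3
      exact absurd h1 (not_lt.2 h3)
  obtain ⟨G, hG, η, hη, hGle⟩ := exists_isTestFunction_of_isCompact (n := n) (A := A) (K := K) hΛ
    (hBc.inter_left hA) fun y hy => exists_lt_of_lt_testSup hl0 (hlow y hy)
  obtain ⟨P, hP, hP0, hP1, hPneg, hPge, hPder⟩ :=
    exists_smooth_truncation hl0 (show l < l + η by linarith)
  have hPd : ∀ t, DifferentiableAt ℝ P t := fun t => (hP.differentiable (by simp)).differentiableAt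
  -- On `A` the two gradients never add up: `P ∘ G` has zero differential on `A ∩ B`, and `b` has
  -- zero differential off `B`. On `K` the bump vanishes, since `G > 0` on `A ∩ B` while `G ≤ 0` on
  -- `K ⊆ A`.
  have htest : IsTestFunction n A K Λ fun y => P (G y) + b y := by
    refine ⟨(hP.contMDiff.comp hG.contMDiff).add hbs, fun y hy => ?_, fun y hy v => ?_⟩
    · have hGy := hG.nonpos y hy
      have hby : b y = 0 := by
        by_contra hne
        have := hGle y ⟨hKA hy, hsupp y hne⟩
        linarith
      rw [hby, add_zero]
      exact hPneg _ hGy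
    · have hc : MDifferentiableAt (𝓡 n) 𝓘(ℝ, ℝ) (fun y => P (G y)) y :=
        (hPd (G y)).mdifferentiableAt.comp y (hG.mdifferentiableAt y)
      rw [mvfderiv_fun_add hc (hbs.mdifferentiable (by simp) y), _root_.add_apply,
        mvfderiv_real_comp_apply (hPd _) (hG.mdifferentiableAt y)]
      by_cases hyB : y ∈ B
      · rw [hPder _ (hGle y ⟨hy, hyB⟩), zero_mul, zero_add]
        exact hgrad y v
      · have hby : b y = 0 := by
          by_contra hne
          exact hyB (hsupp y hne)
        rw [mvfderiv_eq_zero_of_nonneg (hbs.mdifferentiable (by simp) y) hbn hby, add_zero, abs_mul,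
          abs_of_nonneg (hP0 _)]
        exact (mul_le_of_le_one_left (abs_nonneg _) (hP1 _)).trans (hG.gradient_le y hy v)
  have h1 := htest.le_testSup x
  have h2 : l ≤ P (G x) := hPge _ (hGle x ⟨hxA, by simp [hB]⟩)
  rw [← hf, ha, ← ENNReal.ofReal_coe_nnreal, hbx] at h1
  have h3 := (ENNReal.ofReal_le_ofReal_iff a.coe_nonneg).1 h1
  simp only [hl] at h2
  linarith

/-- On a complete set `A`, there are smooth cutoff functions with arbitrarily small gradient. -/
theorem exists_cutoff [SigmaCompactSpace M] [IsManifold (𝓡 n) ∞ M] (hb : HasBumps n M Λ)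
    (hΛ : 0 ≤ Λ) (hA : IsComplete A) (hK : IsCompact K) {ε : ℝ} (hε : 0 < ε) :
    ∃ χ : M → ℝ, ContMDiff (𝓡 n) 𝓘(ℝ, ℝ) ∞ χ ∧ (∀ x, 0 ≤ χ x) ∧ (∀ x, χ x ≤ 1) ∧
      (∃ K', IsCompact K' ∧ ∀ x, x ∉ K' → χ x = 0) ∧ (∀ x ∈ A ∩ K, χ x = 1) ∧
      ∀ x ∈ A, ∀ v : TangentSpace (𝓡 n) x, |mvfderiv (𝓡 n) χ x v| ≤ ε * ‖v‖ := by
  have : LocallyCompactSpace M := Manifold.locallyCompact_of_finiteDimensional (𝓡 n)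
  have hAcl : IsClosed A := hA.isClosed
  have hK₀ : IsCompact (A ∩ K) := hK.inter_left hAcl
  obtain ⟨θ, C, hC, hθ, hθ1, hθnn, hθle, hθ0, hθd⟩ := exists_smooth_halfline_cutoff
  -- The gradient of `θ(G / R)` on `A` is at most `CΛ / R`, hence at most `ε`; the summand `1` keeps
  -- `R` positive.
  obtain ⟨R, hR⟩ : ∃ R : ℝ≥0, (R : ℝ) = C * Λ / ε + 1 := ⟨⟨C * Λ / ε + 1, by positivity⟩, rfl⟩
  have hRpos : (0 : ℝ) < R := by rw [hR]; positivity
  have hR1 : C * Λ / R ≤ ε := by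
    rw [div_le_iff₀ hRpos, hR, mul_add, mul_div_cancel₀ _ hε.ne']
    linarith
  have hS : IsCompact {x | x ∈ A ∧ testSup n A (A ∩ K) Λ x ≤ R} := by
    refine isCompact_sublevel_of_slope hA lowerSemicontinuous_testSup
      (fun R x hx hRx hfin => testSup_slope hb hΛ hAcl inter_subset_left R hx hRx hfin) ?_ R
    refine hK₀.of_isClosed_subset
      (hAcl.inter (lowerSemicontinuous_testSup.isClosed_preimage 0)) fun x hx => ?_
    by_contra hxK
    exact absurd hx.2 (not_le.2 (testSup_pos_of_notMem hb hK₀.isClosed hxK))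
  -- `L` and `L'` are nested compact neighbourhoods of the sublevel set. In `A`, the shell between
  -- them lies above the level `R`, so `θ(G / R)` vanishes there before `κ` starts to decrease; off
  -- `A` the gradient of `κ` is left uncontrolled.
  obtain ⟨L, hL, hSL⟩ := exists_compact_superset hS
  obtain ⟨L', hL', hLL'⟩ := exists_compact_superset hL
  obtain ⟨G, hG, η, hη, hGle⟩ := exists_isTestFunction_of_isCompact (n := n) (A := A)
    (K := A ∩ K) (R := R) hΛ ((hL'.diff isOpen_interior).inter_left hAcl) (by
      rintro x ⟨hxA, -, hxL⟩
      refine exists_lt_of_lt_testSup R.coe_nonneg ?_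
      by_contra! hle
      rw [ENNReal.ofReal_coe_nnreal] at hle
      exact hxL (hSL ⟨hxA, hle⟩))
  obtain ⟨κ, hκ0, hκ1, hκ⟩ := exists_contMDiffMap_zero_one_of_isClosed (n := ⊤) (𝓡 n)
    (isOpen_interior (s := L')).isClosed_compl hL.isClosed
    (disjoint_left.2 fun x hx hx' => hx (hLL' hx'))
  set ψ : M → ℝ := fun x => θ (G x / R) with hψ
  have hψs : ContMDiff (𝓡 n) 𝓘(ℝ, ℝ) ∞ ψ :=
    (hθ.comp (contDiff_id.div_const _)).contMDiff.comp hG.contMDiff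
  have hχs : ContMDiff (𝓡 n) 𝓘(ℝ, ℝ) ∞ fun x => κ x * ψ x := κ.contMDiff.mul hψs
  have hχnn : ∀ x, 0 ≤ κ x * ψ x := fun x => mul_nonneg (hκ x).1 (hθnn _)
  have hout : ∀ x, x ∉ L' → κ x * ψ x = 0 := fun x hx => by
    rw [hκ0 fun h => hx (interior_subset h)]
    simp
  refine ⟨fun x => κ x * ψ x, hχs, hχnn, fun x => mul_le_one₀ (hκ x).2 (hθnn _) (hθle _),
    ⟨L', hL', hout⟩, fun x hx => ?_, fun x hx v => ?_⟩
  · have hxL : x ∈ L := interior_subset (hSL ⟨hx.1, (testSup_eq_zero hx).trans_le zero_le⟩)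
    change κ x * θ (G x / R) = 1
    rw [hκ1 hxL, hθ1 _ (div_nonpos_of_nonpos_of_nonneg (hG.nonpos x hx) hRpos.le)]
    simp
  · by_cases hxL : x ∈ interior L
    · have hev : (fun x => κ x * ψ x) =ᶠ[𝓝 x] fun x => θ (G x / R) := by
        filter_upwards [isOpen_interior.mem_nhds hxL] with y hy
        rw [hκ1 (interior_subset hy)]
        simp [hψ]
      have hd : HasDerivAt (fun t => θ (t / R)) (deriv θ (G x / R) * (1 / R)) (G x) :=
        (((hθ.differentiable (by simp)).differentiableAt).hasDerivAt).comp (G x)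
          ((hasDerivAt_id (G x)).div_const (R : ℝ))
      rw [mvfderiv_congr_of_eventuallyEq hev, mvfderiv_real_comp_apply (P := fun t => θ (t / R))
        hd.differentiableAt (hG.mdifferentiableAt x), hd.deriv, abs_mul, abs_mul,
        abs_of_pos (show 0 < 1 / (R : ℝ) by positivity)]
      calc |deriv θ (G x / R)| * (1 / R) * |mvfderiv (𝓡 n) G x v|
          ≤ C * (1 / R) * (Λ * ‖v‖) := by
            gcongr
            · exact hθd _
            · exact hG.gradient_le x hx v
        _ = C * Λ / R * ‖v‖ := by ring
        _ ≤ ε * ‖v‖ := by gcongr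
    · have hzero : κ x * ψ x = 0 := by
        by_cases hxL' : x ∈ L'
        · have := hGle x ⟨hx, hxL', hxL⟩
          have h0 : ψ x = 0 := hθ0 _ (by rw [le_div_iff₀ hRpos]; linarith)
          rw [h0, mul_zero]
        · exact hout x hxL'
      rw [mvfderiv_eq_zero_of_nonneg (hχs.mdifferentiable (by simp) x) hχnn hzero, abs_zero]
      positivity

end Cutoff

end RiemannianSobolev

namespace RiemannianSobolev

/-! ### The Hilbert-Schmidt norm on `T*M ⊗ V` -/

section ENNRealSquares

theorem ennreal_add_sq_le (a b : ℝ≥0∞) : (a + b) ^ 2 ≤ 2 * a ^ 2 + 2 * b ^ 2 := by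
  rcases eq_or_ne a ⊤ with rfl | ha
  · simp
  rcases eq_or_ne b ⊤ with rfl | hb
  · simp
  lift a to NNReal using ha
  lift b to NNReal using hb
  have h : (a + b) ^ 2 ≤ 2 * a ^ 2 + 2 * b ^ 2 := by
    rw [← NNReal.coe_le_coe]
    push_cast
    nlinarith [sq_nonneg ((a : ℝ) - b)]
  exact_mod_cast h

theorem enorm_add_sq_le {W : Type*} [NormedAddCommGroup W] (a b : W) :
    ‖a + b‖ₑ ^ 2 ≤ 2 * ‖a‖ₑ ^ 2 + 2 * ‖b‖ₑ ^ 2 := by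
  refine le_trans ?_ (ennreal_add_sq_le _ _)
  gcongr
  exact enorm_add_le a b

end ENNRealSquares

section Trace

open Matrix

variable {ι W W' : Type*} [Fintype ι] [DecidableEq ι] [NormedAddCommGroup W]
  [InnerProductSpace ℝ W] [NormedAddCommGroup W'] [InnerProductSpace ℝ W']

/-- The square of the Hilbert-Schmidt norm, computed in an arbitrary basis. -/
theorem sum_norm_sq_eq_trace_gram (b : OrthonormalBasis ι ℝ W) (e : Module.Basis ι ℝ W)
    (η : W →L[ℝ] W') :
    ∑ k, ‖η (b k)‖ ^ 2 = trace ((gram ℝ e)⁻¹ * gram ℝ (η ∘ e)) := by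
  set P : Matrix ι ι ℝ := b.toBasis.toMatrix e with hP
  have hPu : IsUnit P := by
    refine IsUnit.of_mul_eq_one (e.toMatrix b.toBasis) ?_
    exact b.toBasis.toMatrix_mul_toMatrix_flip e
  have hPd : IsUnit P.det := (Matrix.isUnit_iff_isUnit_det P).1 hPu
  have he : ∀ i, e i = ∑ k, P k i • b k := fun i => by
    have := b.toBasis.sum_toMatrix_smul_self e i
    simpa [hP] using this.symm
  have hG : gram ℝ e = Pᵀ * P := by
    ext i j
    rw [gram_apply, ← b.sum_inner_mul_inner]
    simp only [Matrix.mul_apply, Matrix.transpose_apply, hP, Module.Basis.toMatrix_apply,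
      OrthonormalBasis.coe_toBasis_repr_apply, OrthonormalBasis.repr_apply_apply]
    exact Finset.sum_congr rfl fun k _ => by rw [real_inner_comm]
  have hH : gram ℝ (η ∘ e) = Pᵀ * gram ℝ (η ∘ b) * P := by
    ext i j
    simp only [gram_apply, Function.comp_apply, he i, he j, map_sum, map_smul, sum_inner,
      inner_sum, inner_smul_left, inner_smul_right, Matrix.mul_apply, Matrix.transpose_apply,
      Finset.sum_mul]
    refine Finset.sum_congr rfl fun k _ => ?_
    rw [Finset.mul_sum]
    refine Finset.sum_congr rfl fun l _ => ?_
    simp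
    ring
  have hT : IsUnit (Pᵀ).det := by rwa [Matrix.det_transpose]
  -- The matrix whose trace is taken becomes `P⁻¹ · gram (η ∘ b) · P`, so the change of basis
  -- disappears by cyclicity.
  rw [hG, hH, Matrix.mul_inv_rev, Matrix.mul_assoc, ← Matrix.mul_assoc (Pᵀ)⁻¹,
    ← Matrix.mul_assoc (Pᵀ)⁻¹, Matrix.nonsing_inv_mul _ hT, Matrix.one_mul, Matrix.trace_mul_comm,
    Matrix.mul_assoc, Matrix.mul_nonsing_inv _ hPd, Matrix.mul_one]
  simp [Matrix.trace, gram_apply]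

end Trace

section Tensor

variable {n : ℕ} {M : Type*} [EMetricSpace M] [ChartedSpace (EuclideanSpace ℝ (Fin n)) M]

instance tangentSpace_finiteDimensional (x : M) : FiniteDimensional ℝ (TangentSpace (𝓡 n) x) :=
  inferInstanceAs (FiniteDimensional ℝ (EuclideanSpace ℝ (Fin n)))

theorem finrank_tangentSpace (x : M) : Module.finrank ℝ (TangentSpace (𝓡 n) x) = n := by
  have : Module.finrank ℝ (EuclideanSpace ℝ (Fin n)) = n := finrank_euclideanSpace_fin
  exact this

variable [RiemannianBundle (fun x : M => TangentSpace (𝓡 n) x)]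

section Fiber

variable {x : M} {W W' : Type*} [NormedAddCommGroup W] [NormedSpace ℝ W] [NormedAddCommGroup W']
  [NormedSpace ℝ W']

theorem tensorNormSq_le_of_forall {η : TangentSpace (𝓡 n) x →L[ℝ] W}
    {ξ : TangentSpace (𝓡 n) x →L[ℝ] W'} {c : ℝ≥0∞} (h : ∀ v, ‖η v‖ₑ ≤ c * ‖ξ v‖ₑ) :
    tensorNormSq η ≤ c ^ 2 * tensorNormSq ξ := by
  rw [tensorNormSq, tensorNormSq, Finset.mul_sum]
  refine Finset.sum_le_sum fun i _ => ?_
  rw [← mul_pow]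
  gcongr
  exact h _

theorem tensorNormSq_add_le (η ξ : TangentSpace (𝓡 n) x →L[ℝ] W) :
    tensorNormSq (η + ξ) ≤ 2 * tensorNormSq η + 2 * tensorNormSq ξ := by
  rw [tensorNormSq, tensorNormSq, tensorNormSq, Finset.mul_sum, Finset.mul_sum,
    ← Finset.sum_add_distrib]
  exact Finset.sum_le_sum fun i _ => enorm_add_sq_le _ _

theorem tensorNormSq_smul (c : ℝ) (η : TangentSpace (𝓡 n) x →L[ℝ] W) :
    tensorNormSq (c • η) = ‖c‖ₑ ^ 2 * tensorNormSq η := by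
  rw [tensorNormSq, tensorNormSq, Finset.mul_sum]
  refine Finset.sum_congr rfl fun i _ => ?_
  rw [_root_.smul_apply, enorm_smul, mul_pow]

theorem tensorNormSq_neg (η : TangentSpace (𝓡 n) x →L[ℝ] W) :
    tensorNormSq (-η) = tensorNormSq η := by
  simp only [tensorNormSq, _root_.neg_apply, enorm_neg]

theorem tensorNormSq_smulRight (α : TangentSpace (𝓡 n) x →L[ℝ] ℝ) (w : W) :
    tensorNormSq (α.smulRight w) = ‖w‖ₑ ^ 2 * tensorNormSq α := by
  rw [tensorNormSq, tensorNormSq, Finset.mul_sum]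
  refine Finset.sum_congr rfl fun i _ => ?_
  rw [ContinuousLinearMap.smulRight_apply, enorm_smul, mul_pow, mul_comm]

theorem tensorNormSq_le_of_bound {α : TangentSpace (𝓡 n) x →L[ℝ] ℝ} {c : ℝ}
    (h : ∀ v, |α v| ≤ c * ‖v‖) : tensorNormSq α ≤ n * ENNReal.ofReal c ^ 2 := by
  rw [tensorNormSq]
  refine (Finset.sum_le_card_nsmul _ _ (ENNReal.ofReal c ^ 2) fun i _ => ?_).trans_eq ?_
  · gcongr
    rw [← ofReal_norm]
    refine ENNReal.ofReal_le_ofReal ((h _).trans_eq ?_)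
    rw [(stdOrthonormalBasis ℝ (TangentSpace (𝓡 n) x)).norm_eq_one, mul_one]
  · rw [Finset.card_univ, Fintype.card_fin, finrank_tangentSpace, nsmul_eq_mul]

end Fiber

variable {F : Type*} [NormedAddCommGroup F] [NormedSpace ℝ F]
  {V : M → Type*} [TopologicalSpace (TotalSpace F V)]
  [∀ x, NormedAddCommGroup (V x)] [∀ x, InnerProductSpace ℝ (V x)]
  [FiberBundle F V] [VectorBundle ℝ F V] [IsContMDiffRiemannianBundle (𝓡 n) ∞ F V]

/-- The orthonormal bases in the definition of `tensorNormSq` are chosen point by point, with no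
continuity. In a smooth local frame the same quantity is a continuous expression in Gram matrices.
-/
theorem tensorNormSq_eq_trace {x : M} {W : Type*} [NormedAddCommGroup W] [InnerProductSpace ℝ W]
    (b : Module.Basis (Fin n) ℝ (TangentSpace (𝓡 n) x)) (η : TangentSpace (𝓡 n) x →L[ℝ] W) :
    tensorNormSq η =
      ENNReal.ofReal (Matrix.trace ((Matrix.gram ℝ b)⁻¹ * Matrix.gram ℝ (fun i => η (b i)))) := by
  have h1 := sum_norm_sq_eq_trace_gram
    ((stdOrthonormalBasis ℝ (TangentSpace (𝓡 n) x)).reindex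
      (finCongr (finrank_tangentSpace x))) b η
  rw [Function.comp_def] at h1
  rw [← h1, ENNReal.ofReal_sum_of_nonneg fun _ _ => by positivity,
    tensorNormSq, ← (finCongr (finrank_tangentSpace (n := n) x)).sum_comp]
  refine Finset.sum_congr rfl fun i _ => ?_
  rw [ENNReal.ofReal_pow (norm_nonneg _), ofReal_norm, OrthonormalBasis.reindex_apply,
    Equiv.symm_apply_apply]

theorem continuousAt_trace_inv_mul {X ι : Type*} [TopologicalSpace X] [Fintype ι] [DecidableEq ι]
    {G H : X → Matrix ι ι ℝ} {x₀ : X} (hG : ContinuousAt G x₀) (hH : ContinuousAt H x₀)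
    (hdet : (G x₀).det ≠ 0) : ContinuousAt (fun x => Matrix.trace ((G x)⁻¹ * H x)) x₀ := by
  have hdetc : ContinuousAt (fun x => (G x).det) x₀ :=
    (continuous_id.matrix_det.continuousAt).comp hG
  have hadj : ContinuousAt (fun x => (G x).adjugate) x₀ :=
    (continuous_id.matrix_adjugate.continuousAt).comp hG
  have hform : ∀ x, Matrix.trace ((G x)⁻¹ * H x) =
      ((G x).det)⁻¹ * Matrix.trace ((G x).adjugate * H x) := fun x => by
    rw [Matrix.inv_def, Matrix.smul_mul, Matrix.trace_smul, Ring.inverse_eq_inv', smul_eq_mul]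
  simp only [hform]
  refine (hdetc.inv₀ hdet).mul ?_
  exact ((continuous_fst.matrix_mul continuous_snd).matrix_trace.continuousAt).comp
    (f := fun x => ((G x).adjugate, H x)) (hadj.prodMk hH)

omit [RiemannianBundle fun x : M => TangentSpace (𝓡 n) x] in
theorem continuousAt_gram {κ : Type*} {s : κ → ∀ x, V x} {x₀ : M}
    (hs : ∀ i, ContMDiffAt (𝓡 n) ((𝓡 n).prod 𝓘(ℝ, F)) ∞
      (fun x => TotalSpace.mk' F x (s i x)) x₀) :
    ContinuousAt (fun x => Matrix.gram ℝ fun i => s i x) x₀ :=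
  continuousAt_pi.2 fun i => continuousAt_pi.2 fun j => ((hs i).inner_bundle (hs j)).continuousAt

omit [RiemannianBundle fun x : M => TangentSpace (𝓡 n) x] in
theorem continuousAt_enorm_sq {u : ∀ x, V x} {x₀ : M}
    (hu : ContMDiffAt (𝓡 n) ((𝓡 n).prod 𝓘(ℝ, F)) ∞ (fun x => TotalSpace.mk' F x (u x)) x₀) :
    ContinuousAt (fun x => ‖u x‖ₑ ^ 2) x₀ := by
  have h : ContinuousAt (fun x => inner ℝ (u x) (u x)) x₀ := (hu.inner_bundle hu).continuousAt
  have : (fun x => ‖u x‖ₑ ^ 2) = fun x => ENNReal.ofReal (inner ℝ (u x) (u x)) := by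
    ext x
    rw [real_inner_self_eq_norm_sq, ENNReal.ofReal_pow (norm_nonneg _), ofReal_norm]
  rw [this]
  exact ENNReal.continuous_ofReal.continuousAt.comp h

omit [RiemannianBundle fun x : M => TangentSpace (𝓡 n) x] in
theorem continuous_enorm_sq {u : ∀ x, V x}
    (hu : ContMDiff (𝓡 n) ((𝓡 n).prod 𝓘(ℝ, F)) ∞ (fun x => TotalSpace.mk' F x (u x))) :
    Continuous fun x => ‖u x‖ₑ ^ 2 :=
  continuous_iff_continuousAt.2 fun x => continuousAt_enorm_sq (hu x)

variable [IsManifold (𝓡 n) ∞ M]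
  [IsContMDiffRiemannianBundle (𝓡 n) ∞ (EuclideanSpace ℝ (Fin n))
      (fun x : M => TangentSpace (𝓡 n) x)]

theorem continuousAt_tensorNormSq {η : ∀ x, TangentSpace (𝓡 n) x →L[ℝ] V x} {x₀ : M}
    (hη : ContMDiffAt (𝓡 n) ((𝓡 n).prod 𝓘(ℝ, EuclideanSpace ℝ (Fin n) →L[ℝ] F)) ∞
      (fun x => TotalSpace.mk' (EuclideanSpace ℝ (Fin n) →L[ℝ] F)
        (E := fun x : M => TangentSpace (𝓡 n) x →L[ℝ] V x) x (η x)) x₀) :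
    ContinuousAt (fun x => tensorNormSq (η x)) x₀ := by
  let e := trivializationAt (EuclideanSpace ℝ (Fin n)) (fun x : M => TangentSpace (𝓡 n) x) x₀
  let b₀ := (EuclideanSpace.basisFun (Fin n) ℝ).toBasis
  have hx₀ : x₀ ∈ e.baseSet := FiberBundle.mem_baseSet_trivializationAt' x₀
  let s : Fin n → ∀ x : M, TangentSpace (𝓡 n) x := fun i => e.localFrame b₀ i
  have hs : ∀ i, ContMDiffAt (𝓡 n) ((𝓡 n).prod 𝓘(ℝ, EuclideanSpace ℝ (Fin n))) ∞
      (fun x => TotalSpace.mk' (EuclideanSpace ℝ (Fin n)) x (s i x)) x₀ := fun i =>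
    contMDiffAt_localFrame_of_mem _ e b₀ i hx₀
  have hηs : ∀ i, ContMDiffAt (𝓡 n) ((𝓡 n).prod 𝓘(ℝ, F)) ∞
      (fun x => TotalSpace.mk' F x (η x (s i x))) x₀ := fun i =>
    hη.clm_bundle_apply (hs i)
  have hbasis : ∀ x (hx : x ∈ e.baseSet), (fun i => s i x) = e.basisAt b₀ hx := fun x hx => by
    funext i
    simp [s, Trivialization.basisAt, hx]
  have hev : (fun x => tensorNormSq (η x)) =ᶠ[𝓝 x₀] fun x => ENNReal.ofReal (Matrix.trace
      ((Matrix.gram ℝ fun i => s i x)⁻¹ * Matrix.gram ℝ fun i => η x (s i x))) := by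
    filter_upwards [e.open_baseSet.mem_nhds hx₀] with x hx
    have h1 := tensorNormSq_eq_trace (e.basisAt b₀ hx) (η x)
    have h2 : (fun i => η x (e.basisAt b₀ hx i)) = fun i => η x (s i x) :=
      funext fun i => congrArg (η x) (congrFun (hbasis x hx) i).symm
    rw [h2, ← hbasis x hx] at h1
    exact h1
  refine ContinuousAt.congr ?_ hev.symm
  refine ENNReal.continuous_ofReal.continuousAt.comp
    (continuousAt_trace_inv_mul (continuousAt_gram hs) (continuousAt_gram hηs) ?_)
  refine Matrix.det_gram_ne_zero_iff_linearIndependent.2 ?_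
  rw [hbasis x₀ hx₀]
  exact (e.basisAt b₀ hx₀).linearIndependent

theorem continuous_tensorNormSq {η : ∀ x, TangentSpace (𝓡 n) x →L[ℝ] V x}
    (hη : ContMDiff (𝓡 n) ((𝓡 n).prod 𝓘(ℝ, EuclideanSpace ℝ (Fin n) →L[ℝ] F)) ∞
      (fun x => TotalSpace.mk' (EuclideanSpace ℝ (Fin n) →L[ℝ] F)
        (E := fun x : M => TangentSpace (𝓡 n) x →L[ℝ] V x) x (η x))) :
    Continuous fun x => tensorNormSq (η x) :=
  continuous_iff_continuousAt.2 fun x => continuousAt_tensorNormSq (hη x)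

end Tensor

end RiemannianSobolev

namespace RiemannianSobolev

/-! ### Measurability of the norms of measurable sections -/

section Measurability

theorem contMDiffAt_trivializationAt_symm {n : ℕ} {M : Type*} [TopologicalSpace M]
    [ChartedSpace (EuclideanSpace ℝ (Fin n)) M] {F : Type*} [NormedAddCommGroup F] [NormedSpace ℝ F]
    {E : M → Type*} [TopologicalSpace (TotalSpace F E)]
    [∀ x, AddCommGroup (E x)] [∀ x, Module ℝ (E x)] [∀ x, TopologicalSpace (E x)]
    [FiberBundle F E] [VectorBundle ℝ F E] [ContMDiffVectorBundle ∞ F E (𝓡 n)]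
    (c : M) (A : F) {x : M} (hx : x ∈ (trivializationAt F E c).baseSet) :
    ContMDiffAt (𝓡 n) ((𝓡 n).prod 𝓘(ℝ, F)) ∞
      (fun x => TotalSpace.mk' F x ((trivializationAt F E c).symm x A)) x := by
  let e := trivializationAt F E c
  have h : ContMDiffOn (𝓡 n) ((𝓡 n).prod 𝓘(ℝ, F)) ∞
      (fun x => TotalSpace.mk' F x (e.symm x A)) e.baseSet := by
    rw [e.contMDiffOn_section_baseSet_iff]
    refine contMDiffOn_const (c := A) |>.congr fun y hy => ?_
    exact congrArg Prod.snd (e.apply_mk_symm hy A)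
  exact h.contMDiffAt (e.open_baseSet.mem_nhds hx)

variable {n : ℕ} {M : Type*} [EMetricSpace M] [SecondCountableTopology M]
  [ChartedSpace (EuclideanSpace ℝ (Fin n)) M]
  [RiemannianBundle (fun x : M => TangentSpace (𝓡 n) x)] [MeasurableSpace M] [BorelSpace M]

/-- In a trivialisation, `N` is a Carathéodory function: continuous in the fibre coordinate and
measurable in the base point, hence jointly measurable. Countably many trivialisation domains cover
`M`. -/
theorem MeasurableSection.aemeasurable_comp {F : Type*} [NormedAddCommGroup F] [NormedSpace ℝ F]
    [SecondCountableTopology F] {E : M → Type*} [TopologicalSpace (TotalSpace F E)]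
    [∀ x, AddCommGroup (E x)] [∀ x, Module ℝ (E x)] [∀ x, TopologicalSpace (E x)]
    [FiberBundle F E] [VectorBundle ℝ F E] {N : ∀ x, E x → ℝ≥0∞} (hN : ∀ x, Continuous (N x))
    (hNc : ∀ (c : M) (A : F), ContinuousOn (fun x => N x ((trivializationAt F E c).symm x A))
      (trivializationAt F E c).baseSet)
    {u : ∀ x, E x} (hu : MeasurableSection n F u) :
    AEMeasurable (fun x => N x (u x)) (riemannianVolume n M) := by
  classical
  borelize F
  obtain ⟨t, ht, hcov⟩ := TopologicalSpace.countable_cover_nhds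
    (f := fun c : M => (trivializationAt F E c).baseSet)
    fun c => (trivializationAt F E c).open_baseSet.mem_nhds
      (FiberBundle.mem_baseSet_trivializationAt' c)
  have : Countable t := ht.to_subtype
  rw [← Measure.restrict_univ (μ := riemannianVolume n M), ← hcov, biUnion_eq_iUnion,
    aemeasurable_iUnion_iff]
  rintro ⟨c, -⟩
  let e := trivializationAt F E c
  have he : MeasurableSet e.baseSet := e.open_baseSet.measurableSet
  let Φ : F → M → ℝ≥0∞ := fun A => e.baseSet.piecewise (fun x => N x (e.symm x A)) 0
  have hΦ : Measurable (Function.uncurry Φ) := by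
    refine measurable_uncurry_of_continuous_of_measurable (fun x => ?_) fun A =>
      (hNc c A).measurable_piecewise continuousOn_const he
    by_cases hx : x ∈ e.baseSet
    · simp only [Φ, piecewise_eq_of_mem _ _ _ hx]
      exact (hN x).comp ((e.symmL ℝ x).continuous.congr fun A => e.symmL_apply hx A)
    · simp only [Φ, piecewise_eq_of_notMem _ _ _ hx]
      exact continuous_const
  refine (hΦ.comp_aemeasurable ((hu c).aemeasurable.prodMk aemeasurable_id)).congr ?_
  filter_upwards [ae_restrict_mem he] with x hx
  simp only [Function.comp_apply, Function.uncurry_apply_pair, id_eq, Φ]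
  rw [piecewise_eq_of_mem _ _ _ hx]
  exact congrArg (N x) (e.symm_proj_apply ⟨x, u x⟩ hx)

variable {F : Type*} [NormedAddCommGroup F] [NormedSpace ℝ F] [FiniteDimensional ℝ F]
  {V : M → Type*} [TopologicalSpace (TotalSpace F V)]
  [∀ x, NormedAddCommGroup (V x)] [∀ x, InnerProductSpace ℝ (V x)]
  [FiberBundle F V] [VectorBundle ℝ F V] [IsContMDiffRiemannianBundle (𝓡 n) ∞ F V]
  [ContMDiffVectorBundle ∞ F V (𝓡 n)]

theorem MeasurableSection.aemeasurable_enorm_sq {u : ∀ x, V x} (hu : MeasurableSection n F u) :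
    AEMeasurable (fun x => ‖u x‖ₑ ^ 2) (riemannianVolume n M) :=
  hu.aemeasurable_comp (N := fun _ v => ‖v‖ₑ ^ 2)
    (fun _ => (ENNReal.continuous_pow 2).comp continuous_enorm) fun c A _ hx =>
      (continuousAt_enorm_sq (contMDiffAt_trivializationAt_symm (n := n) c A hx)).continuousWithinAt

variable [IsManifold (𝓡 n) ∞ M] [IsContMDiffRiemannianBundle (𝓡 n) ∞ (EuclideanSpace ℝ (Fin n))
      (fun x : M => TangentSpace (𝓡 n) x)]

theorem MeasurableSection.aemeasurable_tensorNormSq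
    {η : ∀ x, TangentSpace (𝓡 n) x →L[ℝ] V x}
    (hη : MeasurableSection n (V := fun x : M => TangentSpace (𝓡 n) x →L[ℝ] V x)
      (EuclideanSpace ℝ (Fin n) →L[ℝ] F) η) :
    AEMeasurable (fun x => tensorNormSq (η x)) (riemannianVolume n M) := by
  refine hη.aemeasurable_comp (N := fun x ξ => tensorNormSq ξ) (fun x => ?_) fun c A x hx =>
    (continuousAt_tensorNormSq (contMDiffAt_trivializationAt_symm (n := n) c A hx)).continuousWithinAt
  unfold tensorNormSq
  exact continuous_finsetSum _ fun i _ => (ENNReal.continuous_pow 2).comp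
    (continuous_enorm.comp (ContinuousLinearMap.apply ℝ (V x) _).continuous)

end Measurability

end RiemannianSobolev

namespace RiemannianSobolev

/-! ### Calculus with the connection -/

section Calculus

variable {n : ℕ} {M : Type*} [EMetricSpace M] [ChartedSpace (EuclideanSpace ℝ (Fin n)) M]
  {F : Type*} [NormedAddCommGroup F] [NormedSpace ℝ F]
  {V : M → Type*} [TopologicalSpace (TotalSpace F V)]
  [∀ x, NormedAddCommGroup (V x)] [∀ x, InnerProductSpace ℝ (V x)]
  [FiberBundle F V] (conn : CovariantDerivative (𝓡 n) F V)

theorem contMDiff_trivial_section_iff {f : M → ℝ} :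
    ContMDiff (𝓡 n) ((𝓡 n).prod 𝓘(ℝ, ℝ)) ∞
      (fun x => TotalSpace.mk' ℝ (E := Bundle.Trivial M ℝ) x (f x)) ↔
    ContMDiff (𝓡 n) 𝓘(ℝ, ℝ) ∞ f := by
  refine forall_congr' fun x => ?_
  rw [Bundle.contMDiffAt_section]
  rfl

theorem conn_smul {u : ∀ x, V x} {g : M → ℝ} {x : M} (hg : MDifferentiableAt (𝓡 n) 𝓘(ℝ, ℝ) g x)
    (hu : MDifferentiableAt (𝓡 n) ((𝓡 n).prod 𝓘(ℝ, F)) (fun x => TotalSpace.mk' F x (u x)) x) :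
    conn.toFun (fun x => g x • u x) x =
      g x • conn.toFun u x + (mvfderiv (𝓡 n) g x).smulRight (u x) :=
  conn.isCovariantDerivativeOnUniv.leibniz hu hg

variable [VectorBundle ℝ F V] [IsManifold (𝓡 n) ∞ M]

theorem contMDiff_conn [conn.ContMDiffCovariantDerivative ∞] {u : ∀ x, V x}
    (hu : ContMDiff (𝓡 n) ((𝓡 n).prod 𝓘(ℝ, F)) ∞ (fun x => TotalSpace.mk' F x (u x))) :
    ContMDiff (𝓡 n) ((𝓡 n).prod 𝓘(ℝ, EuclideanSpace ℝ (Fin n) →L[ℝ] F)) ∞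
      (fun x => TotalSpace.mk' (EuclideanSpace ℝ (Fin n) →L[ℝ] F)
        (E := fun x : M => TangentSpace (𝓡 n) x →L[ℝ] V x) x (conn.toFun u x)) :=
  contMDiffOn_univ.1 <| (CovariantDerivative.ContMDiffCovariantDerivative.contMDiff
    (cov := conn) (k := ∞)).contMDiff hu.contMDiffOn

end Calculus

section NormSquared

variable {n : ℕ} {M : Type*} [EMetricSpace M] [ChartedSpace (EuclideanSpace ℝ (Fin n)) M]
  {F : Type*} [NormedAddCommGroup F] [NormedSpace ℝ F] [FiniteDimensional ℝ F]
  {V : M → Type*} [TopologicalSpace (TotalSpace F V)]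
  [∀ x, NormedAddCommGroup (V x)] [∀ x, InnerProductSpace ℝ (V x)]
  [FiberBundle F V] [VectorBundle ℝ F V] [ContMDiffVectorBundle ∞ F V (𝓡 n)]
  [IsContMDiffRiemannianBundle (𝓡 n) ∞ F V]
  {conn : CovariantDerivative (𝓡 n) F V}

theorem mvfderiv_inner_self (hconn : conn.IsMetricCompatible) {u : ∀ x, V x} {x : M}
    (hu : MDifferentiableAt (𝓡 n) ((𝓡 n).prod 𝓘(ℝ, F)) (fun x => TotalSpace.mk' F x (u x)) x)
    (v : TangentSpace (𝓡 n) x) :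
    mvfderiv (𝓡 n) (fun y => inner ℝ (u y) (u y)) x v = 2 * inner ℝ (u x) (conn.toFun u x v) := by
  classical
  -- Compatibility is a pointwise identity in the vector field, so any field with value `v` at `x`
  -- will do, even a discontinuous one.
  have h := hconn.mvfderiv_inner_eq (Function.update 0 x v) hu hu
  simp only [Function.update_self] at h
  rw [h, real_inner_comm, ← two_mul]

end NormSquared

/-! ### Bounded approximation -/

section Triangle

variable {n : ℕ} {M : Type*} [EMetricSpace M] [ChartedSpace (EuclideanSpace ℝ (Fin n)) M]
  [RiemannianBundle (fun x : M => TangentSpace (𝓡 n) x)] [MeasurableSpace M]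
  {V : M → Type*} [∀ x, NormedAddCommGroup (V x)]

theorem normSq_add_le {u v : ∀ x, V x}
    (hv : AEMeasurable (fun x => ‖v x‖ₑ ^ 2) (riemannianVolume n M)) :
    normSq n (fun x => u x + v x) ≤ 2 * normSq n u + 2 * normSq n v := by
  rw [normSq, normSq, normSq, ← lintegral_const_mul' _ _ ENNReal.ofNat_ne_top,
    ← lintegral_const_mul' _ _ ENNReal.ofNat_ne_top, ← lintegral_add_right' _ (hv.const_mul _)]
  exact lintegral_mono fun x => enorm_add_sq_le _ _

variable [∀ x, InnerProductSpace ℝ (V x)]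

theorem formNormSq_add_le {η ξ : ∀ x, TangentSpace (𝓡 n) x →L[ℝ] V x}
    (hξ : AEMeasurable (fun x => tensorNormSq (ξ x)) (riemannianVolume n M)) :
    formNormSq (fun x => η x + ξ x) ≤ 2 * formNormSq η + 2 * formNormSq ξ := by
  rw [formNormSq, formNormSq, formNormSq, ← lintegral_const_mul' _ _ ENNReal.ofNat_ne_top,
    ← lintegral_const_mul' _ _ ENNReal.ofNat_ne_top, ← lintegral_add_right' _ (hξ.const_mul _)]
  exact lintegral_mono fun x => tensorNormSq_add_le _ _

end Triangle

section Truncation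

variable {n : ℕ} {M : Type*} [EMetricSpace M] [ChartedSpace (EuclideanSpace ℝ (Fin n)) M]
  [IsManifold (𝓡 n) ∞ M] [RiemannianBundle (fun x : M => TangentSpace (𝓡 n) x)]
  [IsContMDiffRiemannianBundle (𝓡 n) ∞ (EuclideanSpace ℝ (Fin n))
    (fun x : M => TangentSpace (𝓡 n) x)]
  [MeasurableSpace M] [BorelSpace M]
  {F : Type*} [NormedAddCommGroup F] [NormedSpace ℝ F] [FiniteDimensional ℝ F]
  {V : M → Type*} [TopologicalSpace (TotalSpace F V)]
  [∀ x, NormedAddCommGroup (V x)] [∀ x, InnerProductSpace ℝ (V x)]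
  [FiberBundle F V] [VectorBundle ℝ F V] [ContMDiffVectorBundle ∞ F V (𝓡 n)]
  [IsContMDiffRiemannianBundle (𝓡 n) ∞ F V]
  {conn : CovariantDerivative (𝓡 n) F V} [conn.ContMDiffCovariantDerivative ∞]

variable (conn) in
/-- The density `|u|² + |∇u|²`. -/
def energyDensity (u : ∀ x, V x) (x : M) : ℝ≥0∞ := ‖u x‖ₑ ^ 2 + tensorNormSq (conn.toFun u x)

omit [MeasurableSpace M] [BorelSpace M] [FiniteDimensional ℝ F]
  [ContMDiffVectorBundle ∞ F V (𝓡 n)] in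
theorem continuous_energyDensity {u : ∀ x, V x}
    (hu : ContMDiff (𝓡 n) ((𝓡 n).prod 𝓘(ℝ, F)) ∞ (fun x => TotalSpace.mk' F x (u x))) :
    Continuous (energyDensity conn u) :=
  (continuous_enorm_sq hu).add (continuous_tensorNormSq (contMDiff_conn conn hu))

omit [IsManifold (𝓡 n) ∞ M]
  [IsContMDiffRiemannianBundle (𝓡 n) ∞ (EuclideanSpace ℝ (Fin n)) fun x : M => TangentSpace (𝓡 n) x]
  [FiniteDimensional ℝ F] [ContMDiffVectorBundle ∞ F V (𝓡 n)]
  [conn.ContMDiffCovariantDerivative ∞] in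
theorem lintegral_energyDensity {u : ∀ x, V x}
    (hu : ContMDiff (𝓡 n) ((𝓡 n).prod 𝓘(ℝ, F)) ∞ (fun x => TotalSpace.mk' F x (u x))) :
    ∫⁻ x, energyDensity conn u x ∂(riemannianVolume n M) = normSq n u + formNormSq (conn.toFun u) :=
  lintegral_add_left (continuous_enorm_sq hu).measurable _

omit [IsManifold (𝓡 n) ∞ M]
  [IsContMDiffRiemannianBundle (𝓡 n) ∞ (EuclideanSpace ℝ (Fin n)) fun x : M => TangentSpace (𝓡 n) x]
  [MeasurableSpace M] [BorelSpace M] [FiniteDimensional ℝ F] [VectorBundle ℝ F V]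
  [ContMDiffVectorBundle ∞ F V (𝓡 n)] [IsContMDiffRiemannianBundle (𝓡 n) ∞ F V]
  [conn.ContMDiffCovariantDerivative ∞] in
theorem energyDensity_lt_top (u : ∀ x, V x) (x : M) : energyDensity conn u x < ⊤ := by
  rw [energyDensity, tensorNormSq]
  exact ENNReal.add_lt_top.2 ⟨ENNReal.pow_lt_top enorm_lt_top,
    ENNReal.sum_lt_top.2 fun i _ => ENNReal.pow_lt_top enorm_lt_top⟩

omit [IsManifold (𝓡 n) ∞ M]
  [IsContMDiffRiemannianBundle (𝓡 n) ∞ (EuclideanSpace ℝ (Fin n)) fun x : M => TangentSpace (𝓡 n) x]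
  [MeasurableSpace M] [BorelSpace M] [conn.ContMDiffCovariantDerivative ∞] in
-- Take `w = g u` with `g = 1 / (1 + δ|u|²)`. Since `d|u|² = 2⟨u, ∇u⟩`, the term `dg ⊗ u` is at most
-- `2(1 - g)|∇u|`; with `(g - 1)∇u` this gives the factor `3`, squared to `9`. The weight is at most
-- `9` and tends to `0` pointwise as `δ → 0`, as dominated convergence requires.
theorem exists_truncation_energy_le (hconn : conn.IsMetricCompatible) {u : ∀ x, V x}
    (hu : ContMDiff (𝓡 n) ((𝓡 n).prod 𝓘(ℝ, F)) ∞ (fun x => TotalSpace.mk' F x (u x)))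
    {δ : ℝ} (hδ : 0 < δ) :
    ∃ w : ∀ x, V x,
      ContMDiff (𝓡 n) ((𝓡 n).prod 𝓘(ℝ, F)) ∞ (fun x => TotalSpace.mk' F x (w x)) ∧
      (∀ x, ‖w x‖ ≤ Real.sqrt δ⁻¹) ∧
      (∀ x, ‖w x - u x‖ₑ ^ 2 + tensorNormSq (conn.toFun w x - conn.toFun u x) ≤
        9 * ENNReal.ofReal (1 - (1 + δ * ‖u x‖ ^ 2)⁻¹) ^ 2 * energyDensity conn u x) := by
  let r : M → ℝ := fun y => inner ℝ (u y) (u y)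
  have hr : ∀ y, r y = ‖u y‖ ^ 2 := fun y => real_inner_self_eq_norm_sq _
  have hrs : ContMDiff (𝓡 n) 𝓘(ℝ, ℝ) ∞ r := hu.inner_bundle hu
  let P : ℝ → ℝ := fun t => (1 + δ * t)⁻¹
  have hpos : ∀ y, 0 < 1 + δ * r y := fun y => by rw [hr]; positivity
  let g : M → ℝ := fun y => P (r y)
  have hgs : ContMDiff (𝓡 n) 𝓘(ℝ, ℝ) ∞ g := fun y => by
    have h1 : ContDiffAt ℝ ∞ P (r y) :=
      (contDiffAt_const.add (contDiffAt_const.mul contDiffAt_id)).inv (hpos y).ne'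
    exact h1.contMDiffAt.comp y (hrs y)
  have hud : ∀ x, MDifferentiableAt (𝓡 n) ((𝓡 n).prod 𝓘(ℝ, F))
      (fun x => TotalSpace.mk' F x (u x)) x := fun x => (hu x).mdifferentiableAt (by simp)
  have hPd : ∀ y, HasDerivAt P (-δ / (1 + δ * r y) ^ 2) (r y) := fun y => by
    have h1 : HasDerivAt (fun t : ℝ => 1 + δ * t) δ (r y) := by
      simpa using ((hasDerivAt_id (r y)).const_mul δ).const_add 1
    exact h1.inv (hpos y).ne'
  refine ⟨fun x => g x • u x, hgs.smul_section hu, fun x => ?_, fun x => ?_⟩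
  · have hp := hpos x
    refine Real.le_sqrt_of_sq_le ?_
    rw [norm_smul, mul_pow, ← hr x, Real.norm_eq_abs, sq_abs]
    have h0 : 0 ≤ r x := by rw [hr]; positivity
    simp only [g, P]
    rw [inv_pow, inv_mul_le_iff₀ (by positivity), ← div_eq_mul_inv, le_div_iff₀ hδ]
    nlinarith [mul_nonneg hδ.le h0]
  · have hp := hpos x
    have h0 : 0 ≤ r x := by rw [hr]; positivity
    have hg1 : 1 - g x = δ * r x / (1 + δ * r x) := by
      simp only [g, P]
      field_simp
      ring
    have hg0 : 0 ≤ 1 - g x := by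
      rw [hg1]
      positivity
    have hden : 1 ≤ 1 + δ * r x := by nlinarith [mul_nonneg hδ.le h0]
    rw [← hr x]
    change _ ≤ 9 * ENNReal.ofReal (1 - g x) ^ 2 * _
    have key : ∀ v, ‖(conn.toFun (fun x => g x • u x) x - conn.toFun u x) v‖ₑ ≤
        (3 * ENNReal.ofReal (1 - g x)) * ‖conn.toFun u x v‖ₑ := fun v => by
      rw [conn_smul conn ((hgs x).mdifferentiableAt (by simp)) (hud x), _root_.sub_apply,
        _root_.add_apply, _root_.smul_apply, ContinuousLinearMap.smulRight_apply,
        mvfderiv_real_comp_apply (hPd x).differentiableAt ((hrs x).mdifferentiableAt (by simp)),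
        (hPd x).deriv, mvfderiv_inner_self hconn (hud x) v]
      set ξ := conn.toFun u x v
      rw [show (3 : ℝ≥0∞) = ENNReal.ofReal 3 by norm_num, ← ENNReal.ofReal_mul (by norm_num),
        ← ofReal_norm, ← ofReal_norm, ← ENNReal.ofReal_mul (by positivity)]
      refine ENNReal.ofReal_le_ofReal ?_
      have e1 : g x • ξ + (-δ / (1 + δ * r x) ^ 2 * (2 * inner ℝ (u x) ξ)) • u x - ξ =
          (-(1 - g x)) • ξ + (-δ / (1 + δ * r x) ^ 2 * (2 * inner ℝ (u x) ξ)) • u x := by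
        module
      rw [e1]
      refine (norm_add_le _ _).trans ?_
      rw [norm_smul, norm_smul, norm_neg, Real.norm_of_nonneg hg0, norm_mul, norm_div, norm_neg,
        Real.norm_of_nonneg hδ.le, Real.norm_of_nonneg (by positivity : 0 ≤ (1 + δ * r x) ^ 2),
        norm_mul, Real.norm_ofNat, Real.norm_eq_abs]
      have h2 : δ / (1 + δ * r x) ^ 2 * (2 * |inner ℝ (u x) ξ|) * ‖u x‖ ≤
          2 * (1 - g x) * ‖ξ‖ := by
        calc δ / (1 + δ * r x) ^ 2 * (2 * |inner ℝ (u x) ξ|) * ‖u x‖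
            ≤ δ / (1 + δ * r x) * (2 * (‖u x‖ * ‖ξ‖)) * ‖u x‖ := by
              gcongr
              · exact le_self_pow₀ hden two_ne_zero
              · exact abs_real_inner_le_norm _ _
          _ = 2 * (δ * ‖u x‖ ^ 2 / (1 + δ * r x)) * ‖ξ‖ := by ring
          _ = 2 * (1 - g x) * ‖ξ‖ := by rw [hg1, ← hr x]
      linarith
    have h3 := tensorNormSq_le_of_forall key
    have h4 : ‖g x • u x - u x‖ₑ ^ 2 ≤ 9 * ENNReal.ofReal (1 - g x) ^ 2 * ‖u x‖ₑ ^ 2 := by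
      have : g x • u x - u x = (-(1 - g x)) • u x := by module
      rw [this, enorm_smul, enorm_neg, Real.enorm_of_nonneg hg0, mul_pow, mul_assoc]
      exact le_mul_of_one_le_left zero_le (by norm_num)
    rw [energyDensity, mul_add]
    refine add_le_add h4 (h3.trans_eq ?_)
    rw [mul_pow]
    norm_num

theorem exists_bounded_approx (hconn : conn.IsMetricCompatible) {u : ∀ x, V x}
    (hu : ContMDiff (𝓡 n) ((𝓡 n).prod 𝓘(ℝ, F)) ∞ (fun x => TotalSpace.mk' F x (u x)))
    (hf : ∫⁻ x, energyDensity conn u x ∂(riemannianVolume n M) ≠ ⊤) {ε : ℝ≥0∞} (hε : ε ≠ 0) :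
    ∃ w : ∀ x, V x,
      ContMDiff (𝓡 n) ((𝓡 n).prod 𝓘(ℝ, F)) ∞ (fun x => TotalSpace.mk' F x (w x)) ∧
      (∃ B, ∀ x, ‖w x‖ ≤ B) ∧ normSq n (fun x => w x - u x) ≤ ε ∧
      formNormSq (fun x => conn.toFun w x - conn.toFun u x) ≤ ε := by
  let ρ : ℕ → M → ℝ≥0∞ := fun k x =>
    9 * ENNReal.ofReal (1 - (1 + (k + 1 : ℝ)⁻¹ * ‖u x‖ ^ 2)⁻¹) ^ 2
  have hcu : Continuous fun x => ‖u x‖ ^ 2 := by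
    have h : Continuous fun x => inner ℝ (u x) (u x) := (hu.inner_bundle hu).continuous
    simpa only [real_inner_self_eq_norm_sq] using h
  have hlim : Tendsto (fun k : ℕ => ∫⁻ x, ρ k x * energyDensity conn u x ∂(riemannianVolume n M))
      atTop (𝓝 (∫⁻ x : M, 0 ∂(riemannianVolume n M))) := by
    refine tendsto_lintegral_of_dominated_convergence
      (fun x => 9 * energyDensity conn u x) (fun k => ?_) (fun k => ae_of_all _ fun x => ?_) ?_
      (ae_of_all _ fun x => ?_)
    · refine Measurable.mul ?_ (continuous_energyDensity hu).measurable
      refine Continuous.measurable ?_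
      refine ENNReal.continuous_const_mul ENNReal.ofNat_ne_top |>.comp ?_
      refine (ENNReal.continuous_pow 2).comp (ENNReal.continuous_ofReal.comp ?_)
      exact continuous_const.sub ((continuous_const.add (continuous_const.mul hcu)).inv₀
        fun x => (show (0 : ℝ) < 1 + (k + 1 : ℝ)⁻¹ * ‖u x‖ ^ 2 by positivity).ne')
    · dsimp only [ρ]
      gcongr
      refine mul_le_of_le_one_right zero_le (pow_le_one₀ zero_le ?_)
      rw [ENNReal.ofReal_le_one]
      have : 0 ≤ (1 + (k + 1 : ℝ)⁻¹ * ‖u x‖ ^ 2)⁻¹ := by positivity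
      linarith
    · rw [lintegral_const_mul' _ _ ENNReal.ofNat_ne_top]
      exact ENNReal.mul_ne_top ENNReal.ofNat_ne_top hf
    · have h1 : Tendsto (fun k : ℕ => 1 - (1 + (k + 1 : ℝ)⁻¹ * ‖u x‖ ^ 2)⁻¹) atTop
          (𝓝 (1 - (1 + 0 * ‖u x‖ ^ 2)⁻¹)) := by
        refine tendsto_const_nhds.sub (Tendsto.inv₀ (tendsto_const_nhds.add
          (Tendsto.mul_const _ ?_)) (by norm_num))
        simpa using tendsto_one_div_add_atTop_nhds_zero_nat (𝕜 := ℝ)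
      have h2 : Tendsto (fun k => ρ k x) atTop (𝓝 (9 * ENNReal.ofReal 0 ^ 2)) := by
        have h3 := ((ENNReal.continuous_const_mul (ENNReal.ofNat_ne_top (n := 9))).comp
          ((ENNReal.continuous_pow 2).comp ENNReal.continuous_ofReal)).continuousAt.tendsto.comp h1
        simp only [zero_mul, add_zero, inv_one, sub_self] at h3
        exact h3
      have h4 := ENNReal.Tendsto.mul_const h2 (Or.inr (energyDensity_lt_top (conn := conn) u x).ne)
      simpa using h4
  rw [lintegral_zero] at hlim
  obtain ⟨k, hk⟩ := (hlim.eventually_lt_const (pos_iff_ne_zero.2 hε)).exists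
  obtain ⟨w, hw, hB, hest⟩ := exists_truncation_energy_le hconn hu
    (δ := (k + 1 : ℝ)⁻¹) (by positivity)
  refine ⟨w, hw, ⟨_, hB⟩, le_trans ?_ hk.le, le_trans ?_ hk.le⟩
  · exact lintegral_mono fun x => le_trans le_self_add (hest x)
  · exact lintegral_mono fun x => le_trans le_add_self (hest x)

end Truncation

end RiemannianSobolev

namespace RiemannianSobolev

/-! ### Potentials of the Cauchy boundary -/

section Potential

variable {n : ℕ} {M : Type*} [EMetricSpace M] [ChartedSpace (EuclideanSpace ℝ (Fin n)) M]

/-- The complement of `Ω` is closed in the completion, hence complete, and it consists of points of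
`M` because `Ω` contains the whole boundary. -/
theorem isComplete_setOf_coe_notMem {Ω : Set (UniformSpace.Completion M)} (hΩ : IsOpen Ω)
    (hb : cauchyBoundary M ⊆ Ω) : IsComplete {x : M | (x : UniformSpace.Completion M) ∉ Ω} := by
  rw [← (UniformSpace.Completion.isUniformInducing_coe M).isComplete_iff]
  have : ((↑) : M → UniformSpace.Completion M) '' {x : M | (x : UniformSpace.Completion M) ∉ Ω} =
      Ωᶜ := by
    ext y
    constructor
    · rintro ⟨x, hx, rfl⟩
      exact hx
    · intro hy
      have : y ∈ range ((↑) : M → UniformSpace.Completion M) := by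
        by_contra h
        exact hy (hb h)
      obtain ⟨x, rfl⟩ := this
      exact ⟨x, hy, rfl⟩
  rw [this]
  exact hΩ.isClosed_compl.isComplete

variable [SecondCountableTopology M]
  [IsManifold (𝓡 n) ∞ M] [RiemannianBundle (fun x : M => TangentSpace (𝓡 n) x)]
  [IsContMDiffRiemannianBundle (𝓡 n) ∞ (EuclideanSpace ℝ (Fin n))
    (fun x : M => TangentSpace (𝓡 n) x)]
  [MeasurableSpace M] [BorelSpace M]

/-- The order of the quantifiers matters: `A` and `φ` depend on `δ` alone, so a cutoff adapted to
`A` can be built before the accuracy `δ'` of `s` is fixed. The energy bound on `s` does not involve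
`δ'`. -/
theorem IsPolar.exists_potential (h : IsPolar n (cauchyBoundary M)) {δ : ℝ≥0∞} (hδ : δ ≠ 0) :
    ∃ A : Set M, IsComplete A ∧ ∃ φ : M → ℝ, (∀ᵐ x ∂(riemannianVolume n M), x ∉ A → φ x = 1) ∧
      ∀ δ' : ℝ≥0∞, δ' ≠ 0 → ∃ s : M → ℝ, ContMDiff (𝓡 n) 𝓘(ℝ, ℝ) ∞ s ∧
        Continuous (fun x => tensorNormSq (mvfderiv (𝓡 n) s x)) ∧
        ∫⁻ x, ‖s x - φ x‖ₑ ^ 2 ∂(riemannianVolume n M) ≤ δ' ∧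
        ∫⁻ x, ‖s x‖ₑ ^ 2 ∂(riemannianVolume n M) ≤ 4 * δ ∧
        ∫⁻ x, tensorNormSq (mvfderiv (𝓡 n) s x) ∂(riemannianVolume n M) ≤ 4 * δ := by
  have h0 : capacity n (cauchyBoundary M) < δ := by
    rw [h]
    exact pos_iff_ne_zero.2 hδ
  simp only [capacity, capOpen, iInf_lt_iff] at h0
  obtain ⟨Ω, hΩ, hb, φ, η, ⟨⟨hφm, -, hηm, -, s, hs, hsφ, hsη⟩, -, hone⟩, hlt⟩ := h0
  refine ⟨_, isComplete_setOf_coe_notMem hΩ hb, φ, ?_, fun δ' hδ' => ?_⟩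
  · filter_upwards [hone] with x hx hxA
    exact hx (not_not.1 hxA)
  have hm : min δ δ' ≠ 0 := by
    rcases min_choice δ δ' with h | h <;> rw [h] <;> assumption
  obtain ⟨k, hk, hk'⟩ := ((hsφ.eventually_lt_const (pos_iff_ne_zero.2 hm)).and
    (hsη.eventually_lt_const (pos_iff_ne_zero.2 hδ))).exists
  obtain ⟨hsm, -, hdsm, -⟩ := hs k
  refine ⟨s k, contMDiff_trivial_section_iff.1 hsm, continuous_tensorNormSq hdsm,
    hk.le.trans (min_le_right _ _), ?_, ?_⟩
  · have h1 := normSq_add_le (n := n) (u := fun x => s k x - φ x) hφm.aemeasurable_enorm_sq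
    simp only [sub_add_cancel] at h1
    calc _ ≤ _ := h1
      _ ≤ 2 * δ + 2 * δ := by
        gcongr
        · exact hk.le.trans (min_le_left _ _)
        · exact le_self_add.trans hlt.le
      _ = 4 * δ := by ring
  · have h1 := formNormSq_add_le (η := fun x => scalarDifferential n M (s k) x - η x)
      hηm.aemeasurable_tensorNormSq
    simp only [sub_add_cancel] at h1
    calc _ ≤ _ := h1
      _ ≤ 2 * δ + 2 * δ := by
        gcongr
        exact le_add_self.trans hlt.le
      _ = 4 * δ := by ring

end Potential

/-! ### The rational truncation `2 t / (1 + t ^ 2)` -/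

section Rational

/-- A smooth function with values in `[-1, 1]`, which takes the value `1` only at `1`. -/
def ratTrunc (t : ℝ) : ℝ := 2 * t / (1 + t ^ 2)

theorem contDiff_ratTrunc : ContDiff ℝ ∞ ratTrunc :=
  (contDiff_const.mul contDiff_id).div (contDiff_const.add (contDiff_id.pow 2))
    fun t => by positivity

theorem one_sub_ratTrunc (t : ℝ) : 1 - ratTrunc t = (1 - t) ^ 2 / (1 + t ^ 2) := by
  rw [ratTrunc, eq_div_iff (by positivity), sub_mul, div_mul_cancel₀ _ (by positivity)]
  ring

theorem one_sub_ratTrunc_nonneg (t : ℝ) : 0 ≤ 1 - ratTrunc t := by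
  rw [one_sub_ratTrunc]
  positivity

theorem one_sub_ratTrunc_le (t : ℝ) : 1 - ratTrunc t ≤ 2 := by
  rw [one_sub_ratTrunc, div_le_iff₀ (by positivity)]
  nlinarith [sq_nonneg (1 + t)]

theorem sq_one_sub_ratTrunc_le (t : ℝ) : (1 - ratTrunc t) ^ 2 ≤ 2 * (1 - t) ^ 2 := by
  have h1 : 1 - ratTrunc t ≤ (1 - t) ^ 2 := by
    rw [one_sub_ratTrunc]
    exact div_le_self (by positivity) (by nlinarith)
  nlinarith [one_sub_ratTrunc_le t, one_sub_ratTrunc_nonneg t]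

theorem sq_ratTrunc_le (t : ℝ) : ratTrunc t ^ 2 ≤ 4 * t ^ 2 := by
  rw [ratTrunc, div_pow, div_le_iff₀ (by positivity)]
  nlinarith [sq_nonneg t, sq_nonneg (t ^ 2), sq_nonneg (t ^ 3)]

theorem abs_deriv_ratTrunc_le (t : ℝ) : |deriv ratTrunc t| ≤ 2 := by
  have h1 : HasDerivAt (fun t : ℝ => 2 * t) 2 t := by simpa using (hasDerivAt_id t).const_mul 2
  have h2 : HasDerivAt (fun t : ℝ => 1 + t ^ 2) (2 * t) t := by
    simpa using (hasDerivAt_pow 2 t).const_add 1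
  have h3 : HasDerivAt ratTrunc _ t := h1.div h2 (by positivity)
  rw [h3.deriv, abs_div, abs_of_nonneg (by positivity : 0 ≤ (1 + t ^ 2) ^ 2),
    div_le_iff₀ (by positivity), abs_le]
  constructor <;> nlinarith [sq_nonneg t, sq_nonneg (t ^ 2)]

end Rational

/-! ### Choosing constants -/

section Constants

/-- Continuity from above of the finite measure with density `f`. It discards both the set of large
energy density and the complement of a large compact set. -/
theorem exists_setLIntegral_lt_of_iInter_eq_empty {X : Type*} [MeasurableSpace X] {μ : Measure X}
    {f : X → ℝ≥0∞} (hf : ∫⁻ x, f x ∂μ ≠ ⊤) {S : ℕ → Set X} (hS : ∀ k, MeasurableSet (S k))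
    (hanti : Antitone S) (hempty : ⋂ k, S k = ∅) {ε : ℝ≥0∞} (hε : ε ≠ 0) :
    ∃ k, ∫⁻ x in S k, f x ∂μ < ε := by
  have : IsFiniteMeasure (μ.withDensity f) := isFiniteMeasure_withDensity hf
  have h := tendsto_measure_iInter_atTop (μ := μ.withDensity f)
    (fun k => (hS k).nullMeasurableSet) hanti ⟨0, measure_ne_top _ _⟩
  rw [hempty, measure_empty] at h
  obtain ⟨k, hk⟩ := (h.eventually_lt_const (pos_iff_ne_zero.2 hε)).exists
  exact ⟨k, by rwa [Function.comp_apply, withDensity_apply _ (hS k)] at hk⟩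

theorem exists_bound_of_isCompact {X : Type*} [TopologicalSpace X] {h : X → ℝ≥0∞}
    (hc : Continuous h) (hlt : ∀ x, h x < ⊤) {K : Set X} (hK : IsCompact K) :
    ∃ C, C ≠ ⊤ ∧ ∀ x ∈ K, h x ≤ C := by
  rcases K.eq_empty_or_nonempty with rfl | hne
  · exact ⟨0, ENNReal.zero_ne_top, fun x hx => hx.elim⟩
  · obtain ⟨x, -, hx⟩ := hK.exists_isMaxOn hne hc.continuousOn
    exact ⟨h x, (hlt x).ne, hx⟩

theorem exists_ne_zero_mul_le {C ε : ℝ≥0∞} (hC : C ≠ ⊤) (hε : ε ≠ 0) :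
    ∃ δ, δ ≠ 0 ∧ C * δ ≤ ε := by
  refine ⟨ε / (C + 1), ENNReal.div_ne_zero.2 ⟨hε, by simp [hC]⟩, ?_⟩
  exact (mul_le_mul' le_self_add le_rfl).trans ENNReal.mul_div_le

theorem exists_pos_ofReal_sq_mul_le {C ε : ℝ≥0∞} (hC : C ≠ ⊤) (hε : ε ≠ 0) :
    ∃ r : ℝ, 0 < r ∧ C * ENNReal.ofReal r ^ 2 ≤ ε := by
  obtain ⟨δ, hδ, h⟩ := exists_ne_zero_mul_le hC hε
  have hm : 0 < min δ 1 := lt_min (pos_iff_ne_zero.2 hδ) one_pos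
  obtain ⟨r, hr0, hr⟩ := ENNReal.lt_iff_exists_nnreal_btwn.1 hm
  refine ⟨r, by exact_mod_cast hr0, le_trans ?_ h⟩
  rw [ENNReal.ofReal_coe_nnreal]
  gcongr
  calc (r : ℝ≥0∞) ^ 2 ≤ r := by
        rw [sq]
        exact mul_le_of_le_one_left zero_le (hr.le.trans (min_le_right _ _))
    _ ≤ δ := hr.le.trans (min_le_left _ _)

end Constants

end RiemannianSobolev

namespace RiemannianSobolev

/-! ### Cutting off bounded sections -/

section PointwiseEstimates

variable {n : ℕ} {M : Type*} [EMetricSpace M] [ChartedSpace (EuclideanSpace ℝ (Fin n)) M]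
  [RiemannianBundle (fun x : M => TangentSpace (𝓡 n) x)]

theorem energy_smul_sub_le {x : M} {W : Type*} [NormedAddCommGroup W] [NormedSpace ℝ W] (u : W)
    (ξ : TangentSpace (𝓡 n) x →L[ℝ] W) (α β : TangentSpace (𝓡 n) x →L[ℝ] ℝ) (g a b : ℝ) :
    ‖g • u - u‖ₑ ^ 2 + tensorNormSq (g • ξ + (a • α + b • β).smulRight u - ξ) ≤
      2 * (‖g - 1‖ₑ ^ 2 * (‖u‖ₑ ^ 2 + tensorNormSq ξ)) +
        (4 * (‖a‖ₑ ^ 2 * (‖u‖ₑ ^ 2 * tensorNormSq α)) +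
          4 * (‖b‖ₑ ^ 2 * (‖u‖ₑ ^ 2 * tensorNormSq β))) := by
  have h1 : g • u - u = (g - 1) • u := by module
  have h2 : g • ξ + (a • α + b • β).smulRight u - ξ =
      (g - 1) • ξ + (a • α + b • β).smulRight u := by module
  have h3 := tensorNormSq_add_le ((g - 1) • ξ) ((a • α + b • β).smulRight u)
  have h4 := tensorNormSq_add_le (a • α) (b • β)
  rw [tensorNormSq_smul, tensorNormSq_smulRight] at h3
  rw [tensorNormSq_smul, tensorNormSq_smul] at h4
  rw [h1, h2, enorm_smul, mul_pow]
  calc _ ≤ ‖g - 1‖ₑ ^ 2 * ‖u‖ₑ ^ 2 + (2 * (‖g - 1‖ₑ ^ 2 * tensorNormSq ξ) +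
        2 * (‖u‖ₑ ^ 2 * (2 * (‖a‖ₑ ^ 2 * tensorNormSq α) +
          2 * (‖b‖ₑ ^ 2 * tensorNormSq β)))) := by
        gcongr
        exact h3.trans (by gcongr)
    _ ≤ 2 * (‖g - 1‖ₑ ^ 2 * ‖u‖ₑ ^ 2) + (2 * (‖g - 1‖ₑ ^ 2 * tensorNormSq ξ) +
        2 * (‖u‖ₑ ^ 2 * (2 * (‖a‖ₑ ^ 2 * tensorNormSq α) +
          2 * (‖b‖ₑ ^ 2 * tensorNormSq β)))) := by
        exact add_le_add (le_mul_of_one_le_left zero_le (one_le_two (α := ℝ≥0∞))) le_rfl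
    _ = _ := by ring

end PointwiseEstimates

theorem enorm_sq_eq_ofReal (t : ℝ) : ‖t‖ₑ ^ 2 = ENNReal.ofReal (t ^ 2) := by
  rw [← sq_abs, ENNReal.ofReal_pow (abs_nonneg t), ← Real.norm_eq_abs, ofReal_norm]

theorem enorm_sq_le_of_sq_le {t c : ℝ} (h : t ^ 2 ≤ c) : ‖t‖ₑ ^ 2 ≤ ENNReal.ofReal c := by
  rw [enorm_sq_eq_ofReal]
  exact ENNReal.ofReal_le_ofReal h

theorem enorm_sq_le_mul_add {t k a l b : ℝ} (hk : 0 ≤ k) (hl : 0 ≤ l)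
    (h : t ^ 2 ≤ k * a ^ 2 + l * b ^ 2) :
    ‖t‖ₑ ^ 2 ≤ ENNReal.ofReal k * ‖a‖ₑ ^ 2 + ENNReal.ofReal l * ‖b‖ₑ ^ 2 := by
  rw [enorm_sq_eq_ofReal, enorm_sq_eq_ofReal, enorm_sq_eq_ofReal, ← ENNReal.ofReal_mul hk,
    ← ENNReal.ofReal_mul hl, ← ENNReal.ofReal_add (by positivity) (by positivity)]
  exact ENNReal.ofReal_le_ofReal h

/-! ### Pointwise bounds for the factor `χ (1 - ratTrunc s)` and its gradient -/

section CutoffWeights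

variable {X : Type*} {A K : Set X} {χ s φ : X → ℝ} {f : X → ℝ≥0∞} {x : X}

/-- The factor lies in `[0, 2]`, so its distance to `1` is at most `1`; this suffices where `f > T`
and off `K`. Elsewhere `f ≤ T`, and the squared distance is at most `4s² + 2(s - φ)²`: on `A` since
`χ = 1` and `|ratTrunc s| ≤ 2|s|`, off `A` since `φ = 1` and `4s² + 2(s - 1)² ≥ 1` always. -/
theorem cutoff_weight_le {T : ℝ≥0∞} (h0 : 0 ≤ χ x) (h1 : χ x ≤ 1) (hAK : x ∈ A ∩ K → χ x = 1)
    (hφ : x ∉ A → φ x = 1) :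
    ‖χ x * (1 - ratTrunc (s x)) - 1‖ₑ ^ 2 * f x ≤
      {y | T < f y}.indicator f x + Kᶜ.indicator f x + 4 * T * ‖s x‖ₑ ^ 2 +
        2 * T * ‖s x - φ x‖ₑ ^ 2 := by
  have ha := one_sub_ratTrunc_nonneg (s x)
  have ha' := one_sub_ratTrunc_le (s x)
  have hone : (χ x * (1 - ratTrunc (s x)) - 1) ^ 2 ≤ 1 := by
    have hp : 0 ≤ χ x * (1 - ratTrunc (s x)) := mul_nonneg h0 ha
    have hq : χ x * (1 - ratTrunc (s x)) ≤ 2 := by nlinarith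
    nlinarith
  have hone' : ‖χ x * (1 - ratTrunc (s x)) - 1‖ₑ ^ 2 ≤ 1 := by
    simpa using enorm_sq_le_of_sq_le hone
  by_cases hT : T < f x
  · rw [indicator_of_mem (show x ∈ {y | T < f y} from hT), add_assoc, add_assoc]
    exact (mul_le_of_le_one_left zero_le hone').trans le_self_add
  by_cases hK : x ∈ K
  swap
  · rw [indicator_of_mem (show x ∈ Kᶜ from hK), add_comm (indicator _ _ _), add_assoc, add_assoc]
    exact (mul_le_of_le_one_left zero_le hone').trans le_self_add
  have hle : ‖χ x * (1 - ratTrunc (s x)) - 1‖ₑ ^ 2 ≤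
      ENNReal.ofReal 4 * ‖s x‖ₑ ^ 2 + ENNReal.ofReal 2 * ‖s x - φ x‖ₑ ^ 2 := by
    refine enorm_sq_le_mul_add (by norm_num) (by norm_num) ?_
    by_cases hA : x ∈ A
    · rw [hAK ⟨hA, hK⟩]
      nlinarith [sq_ratTrunc_le (s x), sq_nonneg (s x - φ x)]
    · rw [hφ hA]
      nlinarith [sq_nonneg (2 * s x - 1), sq_nonneg (s x)]
  norm_num at hle
  calc _ ≤ (4 * ‖s x‖ₑ ^ 2 + 2 * ‖s x - φ x‖ₑ ^ 2) * T := mul_le_mul' hle (not_lt.1 hT)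
    _ = 4 * T * ‖s x‖ₑ ^ 2 + 2 * T * ‖s x - φ x‖ₑ ^ 2 := by ring
    _ ≤ _ := by
      gcongr
      exact le_add_self

/-- Here `p` stands for `|u|²|dχ|²`. On `A` it is small by the choice of `χ`; off `A` it is only
bounded, but `φ = 1` there, so `1 - ratTrunc s` is controlled by `s - φ`. -/
theorem cutoff_gradient_weight_le {p κ C : ℝ≥0∞} (hA : x ∈ A → p ≤ κ * f x) (hC : p ≤ C)
    (hφ : x ∉ A → φ x = 1) :
    ‖1 - ratTrunc (s x)‖ₑ ^ 2 * p ≤ 4 * (κ * f x) + 2 * C * ‖s x - φ x‖ₑ ^ 2 := by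
  have ha := one_sub_ratTrunc_nonneg (s x)
  have ha' := one_sub_ratTrunc_le (s x)
  by_cases hx : x ∈ A
  · refine le_trans (mul_le_mul' ?_ (hA hx)) le_self_add
    have := enorm_sq_le_of_sq_le (t := 1 - ratTrunc (s x)) (c := 4) (by nlinarith)
    simpa using this
  · refine le_trans (mul_le_mul' (b := 2 * ‖s x - φ x‖ₑ ^ 2) ?_ hC) ?_
    · have := enorm_sq_le_mul_add (t := 1 - ratTrunc (s x)) (k := 2) (a := s x - φ x) (l := 0)
        (b := 0) (by norm_num) le_rfl
        (by rw [hφ hx]; linarith [sq_one_sub_ratTrunc_le (s x), sq_abs (1 - s x),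
              show (s x - 1) ^ 2 = (1 - s x) ^ 2 by ring])
      simpa using this
    · rw [mul_right_comm]
      exact le_add_self

end CutoffWeights

/-! ### Approximation of bounded sections -/

section Approximation

variable {n : ℕ} {M : Type*} [EMetricSpace M] [SecondCountableTopology M]
  [ChartedSpace (EuclideanSpace ℝ (Fin n)) M]
  [IsManifold (𝓡 n) ∞ M] [RiemannianBundle (fun x : M => TangentSpace (𝓡 n) x)]
  [IsContMDiffRiemannianBundle (𝓡 n) ∞ (EuclideanSpace ℝ (Fin n))
    (fun x : M => TangentSpace (𝓡 n) x)]
  [IsRiemannianManifold (𝓡 n) M] [MeasurableSpace M] [BorelSpace M]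
  {F : Type*} [NormedAddCommGroup F] [NormedSpace ℝ F] [FiniteDimensional ℝ F]
  {V : M → Type*} [TopologicalSpace (TotalSpace F V)]
  [∀ x, NormedAddCommGroup (V x)] [∀ x, InnerProductSpace ℝ (V x)]
  [FiberBundle F V] [VectorBundle ℝ F V] [ContMDiffVectorBundle ∞ F V (𝓡 n)]
  [IsContMDiffRiemannianBundle (𝓡 n) ∞ F V]
  {conn : CovariantDerivative (𝓡 n) F V} [conn.ContMDiffCovariantDerivative ∞]

omit [SecondCountableTopology M] [IsRiemannianManifold (𝓡 n) M] [MeasurableSpace M]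
  [BorelSpace M] in
theorem isContinuousRiemannianBundle_tangentSpace :
    IsContinuousRiemannianBundle (EuclideanSpace ℝ (Fin n))
      (fun x : M => TangentSpace (𝓡 n) x) := by
  obtain ⟨g, hg, h⟩ := IsContMDiffRiemannianBundle.exists_contMDiff (IB := 𝓡 n) (n := ∞)
      (F := EuclideanSpace ℝ (Fin n)) (E := fun x : M => TangentSpace (𝓡 n) x)
  exact ⟨g, hg.continuous, h⟩

omit [SecondCountableTopology M] [IsManifold (𝓡 n) ∞ M]
  [RiemannianBundle fun x : M => TangentSpace (𝓡 n) x]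
  [IsContMDiffRiemannianBundle (𝓡 n) ∞ (EuclideanSpace ℝ (Fin n)) fun x : M => TangentSpace (𝓡 n) x]
  [IsRiemannianManifold (𝓡 n) M] [MeasurableSpace M] [BorelSpace M] in
theorem mvfderiv_mul_one_sub_ratTrunc {χ s : M → ℝ} {x : M}
    (hχ : MDifferentiableAt (𝓡 n) 𝓘(ℝ, ℝ) χ x) (hs : MDifferentiableAt (𝓡 n) 𝓘(ℝ, ℝ) s x) :
    mvfderiv (𝓡 n) (fun y => χ y * (1 - ratTrunc (s y))) x =
      (1 - ratTrunc (s x)) • mvfderiv (𝓡 n) χ x +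
        (-(χ x * deriv ratTrunc (s x))) • mvfderiv (𝓡 n) s x := by
  have hτ : Differentiable ℝ ratTrunc := contDiff_ratTrunc.differentiable (by simp)
  have h1 : MDifferentiableAt (𝓡 n) 𝓘(ℝ, ℝ) (fun y => 1 - ratTrunc (s y)) x :=
    ((hτ.const_sub 1) (s x)).mdifferentiableAt.comp x hs
  rw [mvfderiv_fun_mul hχ h1, add_comm]
  congr 1
  ext v
  have h2 := mvfderiv_real_comp_apply (P := fun t => 1 - ratTrunc t) ((hτ.const_sub 1) (s x)) hs v
  rw [deriv_const_sub] at h2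
  rw [_root_.smul_apply, _root_.smul_apply, smul_eq_mul, smul_eq_mul, h2]
  ring

omit [SecondCountableTopology M] [IsRiemannianManifold (𝓡 n) M] [MeasurableSpace M]
  [BorelSpace M] [FiniteDimensional ℝ F] [ContMDiffVectorBundle ∞ F V (𝓡 n)] in
-- By the Leibniz rule `dχ ⊗ u = ∇(χu) - χ∇u`, a difference of smooth forms whose norms are
-- continuous, hence bounded on the compact set `K`.
theorem exists_bound_smul_gradient (conn : CovariantDerivative (𝓡 n) F V)
    [conn.ContMDiffCovariantDerivative ∞] {u : ∀ x, V x}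
    (hu : ContMDiff (𝓡 n) ((𝓡 n).prod 𝓘(ℝ, F)) ∞ (fun x => TotalSpace.mk' F x (u x)))
    {χ : M → ℝ} (hχ : ContMDiff (𝓡 n) 𝓘(ℝ, ℝ) ∞ χ) {K : Set M} (hK : IsCompact K)
    (hχK : ∀ x, x ∉ K → χ x = 0) :
    ∃ C, C ≠ ⊤ ∧ ∀ x, ‖u x‖ₑ ^ 2 * tensorNormSq (mvfderiv (𝓡 n) χ x) ≤ C := by
  have hχu := hχ.smul_section hu
  have hχD := hχ.smul_section (contMDiff_conn conn hu)
  have hlt : ∀ x (η : TangentSpace (𝓡 n) x →L[ℝ] V x), tensorNormSq η < ⊤ := fun x η => by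
    rw [tensorNormSq]
    exact ENNReal.sum_lt_top.2 fun i _ => ENNReal.pow_lt_top enorm_lt_top
  obtain ⟨C₁, hC₁, h₁⟩ := exists_bound_of_isCompact
    (continuous_tensorNormSq (contMDiff_conn conn hχu)) (fun x => hlt x _) hK
  obtain ⟨C₂, hC₂, h₂⟩ := exists_bound_of_isCompact
    (continuous_tensorNormSq hχD) (fun x => hlt x _) hK
  refine ⟨2 * C₁ + 2 * C₂, by finiteness, fun x => ?_⟩
  by_cases hx : x ∈ K
  · rw [← tensorNormSq_smulRight]
    have h3 : (mvfderiv (𝓡 n) χ x).smulRight (u x) =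
        conn.toFun (fun x => χ x • u x) x + -(χ x • conn.toFun u x) := by
      rw [conn_smul conn ((hχ x).mdifferentiableAt (by simp))
        ((hu x).mdifferentiableAt (by simp))]
      abel
    rw [h3]
    refine (tensorNormSq_add_le _ _).trans ?_
    rw [tensorNormSq_neg]
    gcongr
    · exact h₁ x hx
    · exact h₂ x hx
  · have h3 : mvfderiv (𝓡 n) χ x = 0 := by
      ext v
      have h4 : χ =ᶠ[𝓝 x] fun _ => 0 := by
        filter_upwards [hK.isClosed.isOpen_compl.mem_nhds hx] with y hy using hχK y hy
      rw [mvfderiv_congr_of_eventuallyEq h4, mvfderiv_const]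
    rw [h3, tensorNormSq]
    simp

omit [FiniteDimensional ℝ F] [ContMDiffVectorBundle ∞ F V (𝓡 n)] in
theorem exists_smoothCompact_approx_of_bounded (hpolar : IsPolar n (cauchyBoundary M))
    {u : ∀ x, V x}
    (hu : ContMDiff (𝓡 n) ((𝓡 n).prod 𝓘(ℝ, F)) ∞ (fun x => TotalSpace.mk' F x (u x)))
    {B : ℝ} (hB : ∀ x, ‖u x‖ ≤ B)
    (hf : ∫⁻ x, energyDensity conn u x ∂(riemannianVolume n M) ≠ ⊤) {ε : ℝ≥0∞} (hε : ε ≠ 0) :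
    ∃ w ∈ smoothCompact n F V, normSq n (fun x => w x - u x) ≤ ε ∧
      formNormSq (fun x => conn.toFun w x - conn.toFun u x) ≤ ε := by
  have := isContinuousRiemannianBundle_tangentSpace (n := n) (M := M)
  have : LocallyCompactSpace M := Manifold.locallyCompact_of_finiteDimensional (𝓡 n)
  set μ := riemannianVolume n M with hμ
  set f := energyDensity conn u with hfdef
  have hfm : Measurable f := (continuous_energyDensity hu).measurable
  obtain ⟨e, he, heε⟩ : ∃ e : ℝ≥0∞, e ≠ 0 ∧ 124 * e ≤ ε :=
    exists_ne_zero_mul_le (ENNReal.ofNat_ne_top (n := 124)) hε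
  obtain ⟨k, hk⟩ := exists_setLIntegral_lt_of_iInter_eq_empty hf
    (S := fun k : ℕ => {x | (k : ℝ≥0∞) < f x}) (fun k => measurableSet_lt measurable_const hfm)
    (fun i j hij x hx => lt_of_le_of_lt (Nat.cast_le.2 hij) (mem_ofPred.1 hx))
    (by
      refine eq_empty_of_forall_notMem fun x hx => ?_
      obtain ⟨k, hk⟩ := ENNReal.exists_nat_gt (energyDensity_lt_top (conn := conn) u x).ne
      exact lt_asymm hk (mem_iInter.1 hx k)) he
  let E := CompactExhaustion.choice M
  obtain ⟨m, hm⟩ := exists_setLIntegral_lt_of_iInter_eq_empty hf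
    (S := fun k : ℕ => (E k)ᶜ) (fun k => (E.isCompact k).measurableSet.compl)
    (fun i j hij => compl_subset_compl.2 (E.subset hij))
    (by rw [← compl_iUnion, E.iUnion_eq, compl_univ]) he
  set T : ℝ≥0∞ := (k : ℝ≥0∞) with hT
  set K := E m
  have hTtop : T ≠ ⊤ := ENNReal.natCast_ne_top k
  have hK : IsCompact K := E.isCompact m
  set β := ENNReal.ofReal (B ^ 2)
  -- The choices depend on each other in this order: `T` and `K` on `u`; `δ` on `T` and on the bound
  -- `β` of `|u|²`; `A` and `φ` on `δ`; `χ` on `A` and `K`; `C` on `χ`; finally `δ'` and `s` on `T`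
  -- and `C`.
  obtain ⟨δ, hδ, hδe⟩ := exists_ne_zero_mul_le (C := T + β) (by finiteness) he
  obtain ⟨A, hA, φ, hφ, hs⟩ := hpolar.exists_potential hδ
  obtain ⟨r, hr, hre⟩ := exists_pos_ofReal_sq_mul_le (C := n * ∫⁻ x, f x ∂μ)
    (ENNReal.mul_ne_top (ENNReal.natCast_ne_top n) hf) he
  obtain ⟨Λ, hΛ, hbump⟩ := exists_bump (n := n) (M := M)
  obtain ⟨χ, hχ, hχ0, hχ1, ⟨K', hK', hχK'⟩, hχAK, hχA⟩ := exists_cutoff hbump hΛ hA hK hr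
  obtain ⟨C, hC, hCle⟩ := exists_bound_smul_gradient conn hu hχ hK' hχK'
  obtain ⟨δ', hδ', hδ'e⟩ := exists_ne_zero_mul_le (C := T + C) (by finiteness) he
  obtain ⟨s, hsm, hdsc, hsφ, hs2, hds⟩ := hs δ' hδ'
  set κ : ℝ≥0∞ := n * ENNReal.ofReal r ^ 2 with hκ
  let g : M → ℝ := fun x => χ x * (1 - ratTrunc (s x))
  have hg : ContMDiff (𝓡 n) 𝓘(ℝ, ℝ) ∞ g :=
    hχ.mul (contMDiff_const.sub (contDiff_ratTrunc.contMDiff.comp hsm))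
  -- `G` gathers the terms of the bound without `φ`. It is measurable, so its integral splits off
  -- although `φ` is not known to be measurable.
  let G : M → ℝ≥0∞ := fun x =>
    2 * ({y | T < f y}.indicator f x + Kᶜ.indicator f x) + 8 * T * ‖s x‖ₑ ^ 2 +
      16 * (κ * f x) + 16 * β * tensorNormSq (mvfderiv (𝓡 n) s x)
  have hSm : MeasurableSet {y | T < f y} := measurableSet_lt measurable_const hfm
  have hKm : MeasurableSet Kᶜ := hK.measurableSet.compl
  have hsqm : Measurable fun x => ‖s x‖ₑ ^ 2 := (hsm.continuous.measurable.enorm).pow_const 2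
  have hGm : Measurable G :=
    (((((hfm.indicator hSm).add (hfm.indicator hKm)).const_mul _).add (hsqm.const_mul _)).add
      ((hfm.const_mul _).const_mul _)).add (hdsc.measurable.const_mul _)
  have hpt : ∀ᵐ x ∂μ, ‖g x • u x - u x‖ₑ ^ 2 +
      tensorNormSq (conn.toFun (fun x => g x • u x) x - conn.toFun u x) ≤
      G x + (4 * T + 8 * C) * ‖s x - φ x‖ₑ ^ 2 := by
    filter_upwards [hφ] with x hφx
    rw [conn_smul conn ((hg x).mdifferentiableAt (by simp)) ((hu x).mdifferentiableAt (by simp)),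
      mvfderiv_mul_one_sub_ratTrunc ((hχ x).mdifferentiableAt (by simp))
        ((hsm x).mdifferentiableAt (by simp))]
    refine (energy_smul_sub_le _ _ _ _ _ _ _).trans ?_
    have h1 := cutoff_weight_le (T := T) (f := f) (s := s) (hχ0 x) (hχ1 x) (hχAK x) hφx
    have h2 := cutoff_gradient_weight_le (f := f) (s := s) (κ := κ) (fun hx => by
      rw [hκ, mul_comm]
      exact mul_le_mul' (tensorNormSq_le_of_bound (hχA x hx)) le_self_add) (hCle x) hφx
    have h3 : ‖-(χ x * deriv ratTrunc (s x))‖ₑ ^ 2 * (‖u x‖ₑ ^ 2 *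
        tensorNormSq (mvfderiv (𝓡 n) s x)) ≤
        4 * (β * tensorNormSq (mvfderiv (𝓡 n) s x)) := by
      refine mul_le_mul' ?_ (mul_le_mul' ?_ le_rfl)
      · have h4 := enorm_sq_le_of_sq_le (t := -(χ x * deriv ratTrunc (s x))) (c := 4) (by
          rw [neg_sq, mul_pow]
          have h5 := abs_le.1 (abs_deriv_ratTrunc_le (s x))
          have h6 : deriv ratTrunc (s x) ^ 2 ≤ 4 := by nlinarith [h5.1, h5.2]
          have h7 : χ x ^ 2 ≤ 1 := by nlinarith [hχ0 x, hχ1 x]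
          nlinarith [sq_nonneg (χ x), sq_nonneg (deriv ratTrunc (s x))])
        simpa using h4
      · rw [← ofReal_norm, ← ENNReal.ofReal_pow (norm_nonneg _)]
        exact ENNReal.ofReal_le_ofReal (pow_le_pow_left₀ (norm_nonneg _) (hB x) 2)
    calc _ ≤ _ := add_le_add (mul_le_mul_right h1 2)
          (add_le_add (mul_le_mul_right h2 4) (mul_le_mul_right h3 4))
      _ = _ := by
        simp only [G]
        ring
  have hint : ∫⁻ x, (‖g x • u x - u x‖ₑ ^ 2 +
      tensorNormSq (conn.toFun (fun x => g x • u x) x - conn.toFun u x)) ∂μ ≤ ε := by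
    calc _ ≤ ∫⁻ x, (G x + (4 * T + 8 * C) * ‖s x - φ x‖ₑ ^ 2) ∂μ := lintegral_mono_ae hpt
      _ = 2 * (∫⁻ x in {y | T < f y}, f x ∂μ + ∫⁻ x in Kᶜ, f x ∂μ) +
            8 * T * ∫⁻ x, ‖s x‖ₑ ^ 2 ∂μ + 16 * (κ * ∫⁻ x, f x ∂μ) +
            16 * β * ∫⁻ x, tensorNormSq (mvfderiv (𝓡 n) s x) ∂μ +
            (4 * T + 8 * C) * ∫⁻ x, ‖s x - φ x‖ₑ ^ 2 ∂μ := by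
          rw [lintegral_add_left hGm, lintegral_const_mul' _ _ (by finiteness),
            lintegral_add_right _ (hdsc.measurable.const_mul _),
            lintegral_add_right _ ((hfm.const_mul _).const_mul _),
            lintegral_add_right _ (hsqm.const_mul _), lintegral_const_mul _ hdsc.measurable,
            lintegral_const_mul _ (hfm.const_mul _), lintegral_const_mul _ hfm,
            lintegral_const_mul _ hsqm,
            lintegral_const_mul' _ _ ENNReal.ofNat_ne_top,
            lintegral_add_right _ (hfm.indicator hKm), lintegral_indicator hSm,
            lintegral_indicator hKm]
      -- Raising `4T` to `8T` lets the last term be absorbed as `8(T + C)δ'`. The contributions `4 +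
      -- 32 + 16 + 64 + 8` add up to `124`.
      _ ≤ 2 * (e + e) + 8 * T * (4 * δ) + 16 * e + 16 * β * (4 * δ) + (8 * T + 8 * C) * δ' := by
          gcongr
          · exact hκ ▸ (by rwa [mul_right_comm])
          · norm_num
      _ ≤ 2 * (e + e) + 32 * ((T + β) * δ) + 16 * e + 64 * ((T + β) * δ) +
            8 * ((T + C) * δ') := by
          have h1 : 8 * T * (4 * δ) ≤ 32 * ((T + β) * δ) := by
            calc 8 * T * (4 * δ) = 32 * (T * δ) := by ring
              _ ≤ _ := by gcongr; exact le_self_add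
          have h2 : 16 * β * (4 * δ) ≤ 64 * ((T + β) * δ) := by
            calc 16 * β * (4 * δ) = 64 * (β * δ) := by ring
              _ ≤ _ := by gcongr; exact le_add_self
          have h3 : (8 * T + 8 * C) * δ' = 8 * ((T + C) * δ') := by ring
          rw [h3]
          gcongr
      _ ≤ 2 * (e + e) + 32 * e + 16 * e + 64 * e + 8 * e := by gcongr
      _ = 124 * e := by ring
      _ ≤ ε := heε
  refine ⟨fun x => g x • u x, ⟨hg.smul_section hu, K', hK', fun x hx => ?_⟩, ?_, ?_⟩
  · simp [g, hχK' x hx]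
  · exact (lintegral_mono fun x => le_self_add).trans hint
  · exact (lintegral_mono fun x => le_add_self).trans hint

end Approximation

end RiemannianSobolev

namespace RiemannianSobolev

/-! ### Equality of the Sobolev spaces -/

section Main

variable {n : ℕ} {M : Type*} [EMetricSpace M] [SecondCountableTopology M]
  [ChartedSpace (EuclideanSpace ℝ (Fin n)) M]
  [IsManifold (𝓡 n) ∞ M] [RiemannianBundle (fun x : M => TangentSpace (𝓡 n) x)]
  [IsContMDiffRiemannianBundle (𝓡 n) ∞ (EuclideanSpace ℝ (Fin n))
    (fun x : M => TangentSpace (𝓡 n) x)]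
  [IsRiemannianManifold (𝓡 n) M] [MeasurableSpace M] [BorelSpace M]
  {F : Type*} [NormedAddCommGroup F] [NormedSpace ℝ F] [FiniteDimensional ℝ F]
  {V : M → Type*} [TopologicalSpace (TotalSpace F V)]
  [∀ x, NormedAddCommGroup (V x)] [∀ x, InnerProductSpace ℝ (V x)]
  [FiberBundle F V] [VectorBundle ℝ F V] [ContMDiffVectorBundle ∞ F V (𝓡 n)]
  [IsContMDiffRiemannianBundle (𝓡 n) ∞ F V]
  {conn : CovariantDerivative (𝓡 n) F V} [conn.ContMDiffCovariantDerivative ∞]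

omit [SecondCountableTopology M] [IsManifold (𝓡 n) ∞ M]
  [IsContMDiffRiemannianBundle (𝓡 n) ∞ (EuclideanSpace ℝ (Fin n)) fun x : M => TangentSpace (𝓡 n) x]
  [IsRiemannianManifold (𝓡 n) M] [FiniteDimensional ℝ F] [ContMDiffVectorBundle ∞ F V (𝓡 n)] in
theorem aemeasurable_enorm_sub_sq {u v : ∀ x, V x}
    (hu : ContMDiff (𝓡 n) ((𝓡 n).prod 𝓘(ℝ, F)) ∞ (fun x => TotalSpace.mk' F x (u x)))
    (hv : ContMDiff (𝓡 n) ((𝓡 n).prod 𝓘(ℝ, F)) ∞ (fun x => TotalSpace.mk' F x (v x))) :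
    AEMeasurable (fun x => ‖u x - v x‖ₑ ^ 2) (riemannianVolume n M) :=
  (continuous_enorm_sq (hu.sub_section hv)).aemeasurable

omit [SecondCountableTopology M] [IsRiemannianManifold (𝓡 n) M] [FiniteDimensional ℝ F]
  [ContMDiffVectorBundle ∞ F V (𝓡 n)] in
theorem aemeasurable_tensorNormSq_conn_sub {u v : ∀ x, V x}
    (hu : ContMDiff (𝓡 n) ((𝓡 n).prod 𝓘(ℝ, F)) ∞ (fun x => TotalSpace.mk' F x (u x)))
    (hv : ContMDiff (𝓡 n) ((𝓡 n).prod 𝓘(ℝ, F)) ∞ (fun x => TotalSpace.mk' F x (v x))) :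
    AEMeasurable (fun x => tensorNormSq (conn.toFun u x - conn.toFun v x))
      (riemannianVolume n M) :=
  (continuous_tensorNormSq
    ((contMDiff_conn conn hu).sub_section (contMDiff_conn conn hv))).aemeasurable

theorem exists_smoothCompact_approx (hconn : conn.IsMetricCompatible)
    (hpolar : IsPolar n (cauchyBoundary M)) {u : ∀ x, V x}
    (hu : u ∈ smoothSobolev F conn.toFun) {ε : ℝ≥0∞} (hε : ε ≠ 0) :
    ∃ w ∈ smoothCompact n F V, normSq n (fun x => w x - u x) ≤ ε ∧
      formNormSq (fun x => conn.toFun w x - conn.toFun u x) ≤ ε := by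
  obtain ⟨hus, hu2, -, hDu⟩ := hu
  obtain ⟨e, he, heε⟩ := exists_ne_zero_mul_le (ENNReal.ofNat_ne_top (n := 4)) hε
  -- As `ε`, and so `e`, may be infinite, the minimum with `1` ensures that the bounded
  -- approximation has finite energy.
  have hm : min e 1 ≠ 0 := by
    rcases min_choice e 1 with h | h <;> rw [h]
    exacts [he, one_ne_zero]
  have hm1 : min e 1 ≠ ⊤ := ((min_le_right e 1).trans_lt ENNReal.one_lt_top).ne
  obtain ⟨v, hvs, ⟨B, hB⟩, hv2, hDv⟩ := exists_bounded_approx hconn hus (by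
    rw [lintegral_energyDensity hus]
    exact ENNReal.add_ne_top.2 ⟨hu2.ne, hDu.ne⟩) hm
  have hvf : ∫⁻ x, energyDensity conn v x ∂(riemannianVolume n M) ≠ ⊤ := by
    rw [lintegral_energyDensity hvs]
    have h1 := normSq_add_le (n := n) (u := fun x => v x - u x)
      (continuous_enorm_sq hus).aemeasurable
    have h2 := formNormSq_add_le (η := fun x => conn.toFun v x - conn.toFun u x)
      (continuous_tensorNormSq (contMDiff_conn conn hus)).aemeasurable
    simp only [sub_add_cancel] at h1 h2
    have h3 := ne_top_of_le_ne_top hm1 hv2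
    have h4 := ne_top_of_le_ne_top hm1 hDv
    have h5 := hu2.ne
    have h6 := hDu.ne
    exact ENNReal.add_ne_top.2 ⟨ne_top_of_le_ne_top (by finiteness) h1,
      ne_top_of_le_ne_top (by finiteness) h2⟩
  obtain ⟨w, hw, hw2, hDw⟩ := exists_smoothCompact_approx_of_bounded hpolar hvs hB hvf he
  have hsum : 2 * e + 2 * e ≤ ε := by
    refine le_trans (le_of_eq ?_) heε
    ring
  refine ⟨w, hw, ?_, ?_⟩
  · have h1 := normSq_add_le (n := n) (u := fun x => w x - v x)
      (aemeasurable_enorm_sub_sq hvs hus)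
    simp only [sub_add_sub_cancel] at h1
    refine h1.trans (le_trans ?_ hsum)
    gcongr
    exact hv2.trans (min_le_left _ _)
  · have h1 := formNormSq_add_le (η := fun x => conn.toFun w x - conn.toFun v x)
      (aemeasurable_tensorNormSq_conn_sub (conn := conn) hvs hus)
    simp only [sub_add_sub_cancel] at h1
    refine h1.trans (le_trans ?_ hsum)
    gcongr
    exact hDv.trans (min_le_left _ _)

omit [IsRiemannianManifold (𝓡 n) M] in
-- Terms far out in the approximating sequence have finite energy because they are at finite
-- distance from a square integrable limit. Local finiteness of the volume is thereby not needed;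
-- dropping the first `N` terms is enough.
theorem sobolevW0_subset_sobolevW : sobolevW0 F conn.toFun ⊆ sobolevW F conn.toFun := by
  rintro u ⟨η, hum, hu2, hηm, hη2, s, hs, hsu, hsη⟩
  obtain ⟨N, hN⟩ := eventually_atTop.1 ((hsu.eventually_lt_const ENNReal.zero_lt_top).and
    (hsη.eventually_lt_const ENNReal.zero_lt_top))
  refine ⟨η, hum, hu2, hηm, hη2, fun k => s (k + N), fun k => ?_,
    hsu.comp (tendsto_add_atTop_nat N), hsη.comp (tendsto_add_atTop_nat N)⟩
  obtain ⟨h1, h2⟩ := hN (k + N) (Nat.le_add_left N k)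
  have h3 := normSq_add_le (n := n) (u := fun x => s (k + N) x - u x) hum.aemeasurable_enorm_sq
  have h4 := formNormSq_add_le (η := fun x => conn.toFun (s (k + N)) x - η x)
    hηm.aemeasurable_tensorNormSq
  simp only [sub_add_cancel] at h3 h4
  exact ⟨(hs _).1, h3.trans_lt (by finiteness), contMDiff_conn conn (hs _).1,
    h4.trans_lt (by finiteness)⟩

/-- The `k`-th term is replaced by a compactly supported section with squared errors at most `1 / (k
+ 1)`; the limit pair `(u, η)` is unchanged. -/
theorem sobolevW_subset_sobolevW0 (hconn : conn.IsMetricCompatible)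
    (hpolar : IsPolar n (cauchyBoundary M)) :
    sobolevW F conn.toFun ⊆ sobolevW0 F conn.toFun := by
  rintro u ⟨η, hum, hu2, hηm, hη2, s, hs, hsu, hsη⟩
  choose w hw hw2 hDw using fun k : ℕ => exists_smoothCompact_approx hconn hpolar (hs k)
    (ENNReal.inv_ne_zero.2 (ENNReal.natCast_ne_top (k + 1)))
  have h0 : Tendsto (fun k : ℕ => (((k + 1 : ℕ) : ℝ≥0∞))⁻¹) atTop (𝓝 0) :=
    ENNReal.tendsto_inv_nat_nhds_zero.comp (tendsto_add_atTop_nat 1)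
  have hlim : ∀ {a : ℕ → ℝ≥0∞}, Tendsto a atTop (𝓝 0) →
      Tendsto (fun k => 2 * a k + 2 * (((k + 1 : ℕ) : ℝ≥0∞))⁻¹) atTop (𝓝 0) := fun ha => by
    have h1 := (ENNReal.Tendsto.const_mul ha (Or.inr (ENNReal.ofNat_ne_top (n := 2)))).add
      (ENNReal.Tendsto.const_mul h0 (Or.inr (ENNReal.ofNat_ne_top (n := 2))))
    simpa only [mul_zero, add_zero] using h1
  refine ⟨η, hum, hu2, hηm, hη2, w, hw, ?_, ?_⟩
  · refine tendsto_of_tendsto_of_tendsto_of_le_of_le tendsto_const_nhds (hlim hsu)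
      (fun _ => zero_le) fun k => ?_
    have h1 := normSq_add_le (n := n) (u := fun x => s k x - u x)
      (aemeasurable_enorm_sub_sq (hw k).1 (hs k).1)
    simp only [sub_add_sub_cancel'] at h1
    exact h1.trans (add_le_add le_rfl (mul_le_mul_right (hw2 k) 2))
  · refine tendsto_of_tendsto_of_tendsto_of_le_of_le tendsto_const_nhds (hlim hsη)
      (fun _ => zero_le) fun k => ?_
    have h1 := formNormSq_add_le (η := fun x => conn.toFun (s k) x - η x)
      (aemeasurable_tensorNormSq_conn_sub (conn := conn) (hw k).1 (hs k).1)
    simp only [sub_add_sub_cancel'] at h1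
    exact h1.trans (add_le_add le_rfl (mul_le_mul_right (hDw k) 2))

end Main

end RiemannianSobolev

end

theorem theorem4p2 {n : ℕ} {M : Type*} [EMetricSpace M] [SecondCountableTopology M]
    [ChartedSpace (EuclideanSpace ℝ (Fin n)) M] [IsManifold (𝓡 n) ∞ M]
    [RiemannianBundle (fun x : M => TangentSpace (𝓡 n) x)]
    [IsContMDiffRiemannianBundle (𝓡 n) ∞ (EuclideanSpace ℝ (Fin n))
      (fun x : M => TangentSpace (𝓡 n) x)]
    [IsRiemannianManifold (𝓡 n) M] [MeasurableSpace M] [BorelSpace M]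
    {F : Type*} [NormedAddCommGroup F] [NormedSpace ℝ F] [FiniteDimensional ℝ F]
    {V : M → Type*} [TopologicalSpace (TotalSpace F V)]
    [∀ x, NormedAddCommGroup (V x)] [∀ x, InnerProductSpace ℝ (V x)]
    [FiberBundle F V] [VectorBundle ℝ F V] [ContMDiffVectorBundle ∞ F V (𝓡 n)]
    [IsContMDiffRiemannianBundle (𝓡 n) ∞ F V]
    (conn : CovariantDerivative (𝓡 n) F V) [conn.ContMDiffCovariantDerivative ∞]
    (hconn : conn.IsMetricCompatible)
    (hpolar : RiemannianSobolev.IsPolar n (RiemannianSobolev.cauchyBoundary M)) :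
    RiemannianSobolev.sobolevW0 F conn.toFun = RiemannianSobolev.sobolevW F conn.toFun := by
  exact Set.Subset.antisymm RiemannianSobolev.sobolevW0_subset_sobolevW
    (RiemannianSobolev.sobolevW_subset_sobolevW0 hconn hpolar)
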